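/- Fix an integer $q\ge 2$ and a real number $s\in[0,1)$. For $n\ge 0$ let $H(n,q)$ be the Hamming graph: its vertices are the $n$-tuples in $(\mathbb Z/q\mathbb Z)^n$, two of them being adjacent if they differ in exactly one coordinate. Let $A_n$ be its adjacency matrix and let $$H_n \;=\; s\,I+(1-s)\,\frac{A_n}{\|A_n\|}$$ ($\|\cdot\|$ the spectral norm; $H_0=sI$). Thus $s=0$ is the normalization $A_n/\|A_n\|$ and $s=\tfrac12$ is a normalization with spectrum in $[0,1]$. Let $\theta_1>\theta_2>\dots>\theta_d$ be the distinct eigenvalues of $H_n$, $E_r$ the orthogonal projection onto the eigenspace of $\theta_r$, and $\Delta_2=\theta_1-\theta_2$. For a vertex $v$ with characteristic vector $w=e_v$ put $$\epsilon_1=\|E_1w\|,\qquad S_1=\sum_{r=2}^d\frac{\|E_rw\|^2}{\theta_1-\theta_r},$$ and for real numbers $\gamma$ and $t\ge 0$ define the fidelity $$f_{\gamma,w}(t)=\operatorname{Tr}\!\big(ww^\dagger\,U(t)\,E_1\,U(t)^{-1}\big),\qquad U(t)=\exp\!\big(-it(\gamma H_n+ww^\dagger)\big).$$ Say that the family $(H_n)$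 is $\gamma$-Groverian, for scalings $\gamma=\gamma(n,w)$, if there are constants $C,c>0$ and $N$ such that for all $n\ge N$ and all vertices $v$ of $H(n,q)$ with $\epsilon_1\ne 0$ there is a time $0\le\tau\le C/\epsilon_1$ with $f_{\gamma(n,w),w}(\tau)\ge c$. Then the following hold as $n\to\infty$ with $q$ and $s$ fixed. 1. The Hamming graphs $H(n,q)$ have optimal spatial search: there are scalings $\gamma_n>0$, independent of the vertex $v$, such that $(H_n)$ is $\gamma_n$-Groverian. 2. Moreover, $(H_n)$ is $S_1$-Groverian, that is, one can take $\gamma=S_1$. 3. For every $n\ge 1$, $H_n$ is Hermitian with eigenvalues in $[2s-1,1]$, and $1$ is a simple eigenvalue; $\Delta_2\asymp 1/n$. For every choice of a vertex $v_n$ of $H(n,q)$ for each $n$, with $w=e_{v_n}$, one has $\epsilon_1=q^{-n/2}$ for all $n$, $S_1=\Theta(1)$, and $\epsilon_1\ll\sqrt{S_1}\,\Delta_2$. The case $q=2$ is the $n$-cube. -/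

import Mathlib

open Filter Asymptotics

noncomputable section

namespace QuantumSearch

section Spectral

variable {E : Type*} [NormedAddCommGroup E] [InnerProductSpace ℂ E] [FiniteDimensional ℂ E]

/-- The set of distinct real eigenvalues of `T` (all the eigenvalues, if `T` is self-adjoint). -/
def eigenvalueSet (T : E →L[ℂ] E) : Set ℝ :=
  {θ | Module.End.HasEigenvalue (T : E →ₗ[ℂ] E) (θ : ℂ)}

/-- The largest eigenvalue `θ₁` (a maximum, since the set of eigenvalues is finite). -/
def principalEigenvalue (T : E →L[ℂ] E) : ℝ :=
  sSup (eigenvalueSet T)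

/-- The second largest distinct eigenvalue `θ₂`. -/
def secondEigenvalue (T : E →L[ℂ] E) : ℝ :=
  sSup (eigenvalueSet T \ {principalEigenvalue T})

/-- The spectral gap `Δ₂ = θ₁ - θ₂`. -/
def spectralGap (T : E →L[ℂ] E) : ℝ :=
  principalEigenvalue T - secondEigenvalue T

/-- The orthogonal projection onto the eigenspace of `T` for `θ`. -/
def eigenProjection (T : E →L[ℂ] E) (θ : ℝ) : E →L[ℂ] E :=
  (Module.End.eigenspace (T : E →ₗ[ℂ] E) (θ : ℂ)).starProjection

/-- The orthogonal projection `E₁` onto the principal eigenspace. -/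
def principalProjection (T : E →L[ℂ] E) : E →L[ℂ] E :=
  eigenProjection T (principalEigenvalue T)

/-- The shadow `ε₁ = ‖E₁ w‖` of `w` on the principal eigenspace. -/
def shadow (T : E →L[ℂ] E) (w : E) : ℝ :=
  ‖principalProjection T w‖

/-- `S_k = ∑_{r ≥ 2} ‖E_r w‖² / (θ₁ - θ_r)^k`, a finite sum over the distinct eigenvalues other
than `θ₁`. -/
def spectralMoment (T : E →L[ℂ] E) (k : ℕ) (w : E) : ℝ :=
  ∑ᶠ θ ∈ eigenvalueSet T \ {principalEigenvalue T},
    ‖eigenProjection T θ w‖ ^ 2 / (principalEigenvalue T - θ) ^ k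

/-- The search Hamiltonian `γ T + |w⟩⟨w|`. -/
def searchHamiltonian (T : E →L[ℂ] E) (γ : ℝ) (w : E) : E →L[ℂ] E :=
  (γ : ℂ) • T + InnerProductSpace.rankOne ℂ w w

/-- The density operator `ρ(t) = exp(-it(γT + |w⟩⟨w|)) E₁ exp(it(γT + |w⟩⟨w|))`. -/
def density (T : E →L[ℂ] E) (γ : ℝ) (w : E) (t : ℝ) : E →L[ℂ] E :=
  NormedSpace.exp ((-(Complex.I * t)) • searchHamiltonian T γ w) * principalProjection T *
    NormedSpace.exp ((Complex.I * t) • searchHamiltonian T γ w)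

/-- The fidelity `f(t) = Tr(|w⟩⟨w| ρ(t))` (a real number when `T` is self-adjoint). -/
def fidelity (T : E →L[ℂ] E) (γ : ℝ) (w : E) (t : ℝ) : ℝ :=
  (LinearMap.trace ℂ E
    ((InnerProductSpace.rankOne ℂ w w * density T γ w t : E →L[ℂ] E) : E →ₗ[ℂ] E)).re

/-- `T` is self-adjoint, its eigenvalues lie in `[a, 1]`, and `1` is a simple eigenvalue. -/
def IsNormalized (a : ℝ) (T : E →L[ℂ] E) : Prop :=
  IsSelfAdjoint T ∧ eigenvalueSet T ⊆ Set.Icc a 1 ∧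
    Module.finrank ℂ (Module.End.eigenspace (T : E →ₗ[ℂ] E) 1) = 1

end Spectral

section Family

variable {E : ℕ → Type*} [∀ n, NormedAddCommGroup (E n)] [∀ n, InnerProductSpace ℂ (E n)]
  [∀ n, FiniteDimensional ℂ (E n)]

/-- The family `T` is `γ`-Groverian for the targets `W n ⊆ E n`: each target `w` with
`‖E₁ w‖ ≠ 0` is found at some time `τ = O(1 / ‖E₁ w‖)` with fidelity `Ω(1)`, with constants that
are uniform in the target. The scaling `γ` may depend on `n` and on the target. -/
def IsGroverianWith (T : ∀ n, E n →L[ℂ] E n) (W : ∀ n, Set (E n)) (γ : ∀ n, E n → ℝ) : Prop :=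
  ∃ C > 0, ∃ c > 0, ∃ N : ℕ, ∀ n ≥ N, ∀ w ∈ W n, shadow (T n) w ≠ 0 →
    ∃ τ : ℝ, 0 ≤ τ ∧ τ ≤ C / shadow (T n) w ∧ c ≤ fidelity (T n) (γ n w) w τ

/-- The family `T` is Groverian (has optimal spatial search) for the targets `W n`: it is
`γ`-Groverian for some positive scaling `γ`, which is not allowed to depend on the target. -/
def IsGroverian (T : ∀ n, E n →L[ℂ] E n) (W : ∀ n, Set (E n)) : Prop :=
  ∃ γ : ℕ → ℝ, (∀ n, 0 < γ n) ∧ IsGroverianWith T W (fun n _ => γ n)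

end Family

section Graphs

variable {V : Type*} [Fintype V] [DecidableEq V]

/-- The characteristic vector of a vertex. -/
def vertexVector (v : V) : EuclideanSpace ℂ V :=
  EuclideanSpace.single v 1

/-- The adjacency operator of `G`. -/
def adjOperator (G : SimpleGraph V) [DecidableRel G.Adj] :
    EuclideanSpace ℂ V →L[ℂ] EuclideanSpace ℂ V :=
  Matrix.toEuclideanCLM (n := V) (𝕜 := ℂ) (G.adjMatrix ℂ)

/-- `s I + (1 - s) A / ‖A‖`, where `‖A‖` is the spectral norm of the adjacency operator. For
`s = 0` this is the normalization `A / ‖A‖` with eigenvalues in `[-1, 1]`; for `s = 1 / 2` its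
eigenvalues are in `[0, 1]`. -/
def normalizedAdj (G : SimpleGraph V) [DecidableRel G.Adj] (s : ℝ) :
    EuclideanSpace ℂ V →L[ℂ] EuclideanSpace ℂ V :=
  (s : ℂ) • 1 + (((1 - s) / ‖adjOperator G‖ : ℝ) : ℂ) • adjOperator G

/-- The Hamming graph `H(n, q)`: the vertices are the `n`-tuples over `ℤ/qℤ`, and two of them are
adjacent if they differ in exactly one coordinate. -/
def hammingGraph (n q : ℕ) : SimpleGraph (Fin n → ZMod q) where
  Adj x y := hammingDist x y = 1
  symm := ⟨fun x y h => by rw [hammingDist_comm]; exact h⟩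
  loopless := ⟨fun x h => by simp at h⟩

instance (n q : ℕ) : DecidableRel (hammingGraph n q).Adj :=
  fun x y => inferInstanceAs (Decidable (hammingDist x y = 1))

/-- The normalized adjacency operator of `H(n, q)`. -/
def hammingOperator (q : ℕ) [NeZero q] (s : ℝ) (n : ℕ) :
    EuclideanSpace ℂ (Fin n → ZMod q) →L[ℂ] EuclideanSpace ℂ (Fin n → ZMod q) :=
  normalizedAdj (hammingGraph n q) s

/-- The targets of the search: the characteristic vectors of the vertices of `H(n, q)`. -/
def hammingTargets (q : ℕ) [NeZero q] (n : ℕ) : Set (EuclideanSpace ℂ (Fin n → ZMod q)) :=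
  Set.range vertexVector

end Graphs

end QuantumSearch

end

open Filter Asymptotics

noncomputable section

namespace QuantumSearch

open scoped InnerProductSpace

/-! ### Spectral data in coordinates of an orthonormal eigenbasis. -/

section EigenBasis

variable {E : Type*} [NormedAddCommGroup E] [InnerProductSpace ℂ E]
  {ι : Type*} [Fintype ι]

/-! At the scaling `γ = S₁` the search is almost a rotation in a plane. Write `w = ε ψ + w'` with
`ψ` a unit vector of the principal eigenspace, let `R` be the reduced resolvent of `T` at `θ₁`, and
put `φ = R w'`, `χ = R² w'`, `r² = S₂ = ‖φ‖²`. Up to the common energy `S₁ θ₁`, the search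
Hamiltonian sends `φ` to `S₁ ε ψ`: the choice of `γ` is what cancels `w`. Correcting `ψ` to `ψ - (ε
/ r²) χ` cancels `w` in its image too. The two vectors are then exchanged with frequency `ω = ε S₁ /
r`, up to an error of order `ε²` along `χ`. After a quarter period `τ = π r / (2 ε S₁)` the
principal state has turned, up to phase, almost into `φ / r`, whose overlap with `w` is `S₁ / √S₂`.
Duhamel's estimate bounds the loss of amplitude by a multiple of `ε ‖χ‖ / r²`, which is at most `ε /
(D r)` for a gap `D`. This is `le_fidelity_of_resolvent` with `le_fidelity_spectralMoment`.

Thus it suffices that `S₁ / √S₂` is bounded below and that `ε / (D √S₂)` tends to zero. For the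
Hamming graph the characters of `(ℤ/qℤ)ⁿ` are eigenvectors, the eigenvalue at `a` lies `κ |a| / n`
below the largest, with `|a|` the Hamming weight, and each vertex has squared overlap `q⁻ⁿ` with
each character. As most weights are proportional to `n`, the moments stay bounded: `S₁ ≥ 1 / (2κ)`
and `S₂ ≤ 24 / κ²`. The gap is `κ / n`, and `n q^(-n/2)` tends to zero. -/

theorem inner_eigenbasis_apply {T : E →L[ℂ] E} {b : OrthonormalBasis ι ℂ E} {μ : ι → ℝ}
    (hb : ∀ i, T (b i) = (μ i : ℂ) • b i) (i : ι) (x : E) :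
    ⟪b i, T x⟫_ℂ = μ i * ⟪b i, x⟫_ℂ := by
  classical
  conv_lhs => rw [← b.sum_repr' x]
  simp [map_sum, hb, orthonormal_iff_ite.mp b.orthonormal, mul_comm]

theorem eigenbasis_ext (b : OrthonormalBasis ι ℂ E) {x y : E}
    (h : ∀ i, ⟪b i, x⟫_ℂ = ⟪b i, y⟫_ℂ) : x = y := by
  rw [← b.sum_repr' x, ← b.sum_repr' y]
  simp [h]

theorem isSelfAdjoint_of_eigenbasis [FiniteDimensional ℂ E] {T : E →L[ℂ] E}
    {b : OrthonormalBasis ι ℂ E} {μ : ι → ℝ} (hb : ∀ i, T (b i) = (μ i : ℂ) • b i) :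
    IsSelfAdjoint T := by
  rw [ContinuousLinearMap.isSelfAdjoint_iff_isSymmetric]
  intro x y
  rw [← b.sum_inner_mul_inner, ← b.sum_inner_mul_inner]
  refine Finset.sum_congr rfl fun i _ => ?_
  rw [← inner_conj_symm]
  simp only [ContinuousLinearMap.coe_coe]
  rw [inner_eigenbasis_apply hb, inner_eigenbasis_apply hb, ← inner_conj_symm x]
  simp
  ring

/-- This criterion reduces eigenvalues, multiplicities and projections to coordinates. -/
theorem mem_eigenspace_iff_inner_eigenbasis {T : E →L[ℂ] E} {b : OrthonormalBasis ι ℂ E}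
    {μ : ι → ℝ} (hb : ∀ i, T (b i) = (μ i : ℂ) • b i) (θ : ℝ) (x : E) :
    x ∈ Module.End.eigenspace (T : E →ₗ[ℂ] E) (θ : ℂ) ↔ ∀ i, μ i ≠ θ → ⟪b i, x⟫_ℂ = 0 := by
  rw [Module.End.mem_eigenspace_iff]
  constructor
  · intro h i hi
    have h1 := inner_eigenbasis_apply hb i x
    rw [ContinuousLinearMap.coe_coe] at h
    rw [h, inner_smul_right] at h1
    have h2 : ((θ : ℂ) - μ i) * ⟪b i, x⟫_ℂ = 0 := by rw [sub_mul, h1, sub_self]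
    exact (mul_eq_zero.mp h2).resolve_left (sub_ne_zero.mpr (by exact_mod_cast hi.symm))
  · intro h
    refine eigenbasis_ext b fun i => ?_
    rw [ContinuousLinearMap.coe_coe, inner_eigenbasis_apply hb, inner_smul_right]
    by_cases hi : μ i = θ
    · rw [hi]
    · rw [h i hi, mul_zero, mul_zero]

theorem eigenvalueSet_eq_range {T : E →L[ℂ] E} {b : OrthonormalBasis ι ℂ E}
    {μ : ι → ℝ} (hb : ∀ i, T (b i) = (μ i : ℂ) • b i) : eigenvalueSet T = Set.range μ := by
  ext θ
  simp only [eigenvalueSet, Set.mem_ofPred_eq, Set.mem_range]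
  constructor
  · intro h
    obtain ⟨x, hx⟩ := h.exists_hasEigenvector
    by_contra! hθ
    refine hx.2 (eigenbasis_ext b fun i => ?_)
    rw [(mem_eigenspace_iff_inner_eigenbasis hb θ x).mp hx.1 i (hθ i), inner_zero_right]
  · rintro ⟨i, rfl⟩
    exact Module.End.hasEigenvalue_of_hasEigenvector (x := b i)
      ⟨Module.End.mem_eigenspace_iff.mpr (hb i), b.orthonormal.ne_zero i⟩

open Classical in
theorem finrank_eigenspace_eq_one {T : E →L[ℂ] E} {b : OrthonormalBasis ι ℂ E}
    {μ : ι → ℝ} (hb : ∀ i, T (b i) = (μ i : ℂ) • b i) {θ : ℝ} {i : ι}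
    (hi : ∀ j, μ j = θ ↔ j = i) :
    Module.finrank ℂ (Module.End.eigenspace (T : E →ₗ[ℂ] E) (θ : ℂ)) = 1 := by
  have hspan : Module.End.eigenspace (T : E →ₗ[ℂ] E) (θ : ℂ) = ℂ ∙ b i := by
    ext x
    rw [mem_eigenspace_iff_inner_eigenbasis hb, Submodule.mem_span_singleton]
    constructor
    · intro h
      refine ⟨⟪b i, x⟫_ℂ, ?_⟩
      conv_rhs => rw [← b.sum_repr' x]
      rw [Finset.sum_eq_single i]
      · intro j _ hj
        rw [h j (fun h' => hj ((hi j).mp h')), zero_smul]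
      · simp
    · rintro ⟨c, rfl⟩ j hj
      have : j ≠ i := fun h => hj ((hi j).mpr h)
      simp [orthonormal_iff_ite.mp b.orthonormal, this]
  rw [hspan, finrank_span_singleton (b.orthonormal.ne_zero i)]

theorem principalEigenvalue_eq {T : E →L[ℂ] E} {b : OrthonormalBasis ι ℂ E}
    {μ : ι → ℝ} (hb : ∀ i, T (b i) = (μ i : ℂ) • b i) {i : ι} (hi : ∀ j, μ j ≤ μ i) :
    principalEigenvalue T = μ i := by
  rw [principalEigenvalue, eigenvalueSet_eq_range hb]
  exact IsGreatest.csSup_eq ⟨⟨i, rfl⟩, by rintro _ ⟨j, rfl⟩; exact hi j⟩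

theorem norm_apply_le_of_eigenbasis {T : E →L[ℂ] E} {b : OrthonormalBasis ι ℂ E}
    {μ : ι → ℝ} (hb : ∀ i, T (b i) = (μ i : ℂ) • b i) {C : ℝ} (hC : 0 ≤ C)
    (hμ : ∀ i, |μ i| ≤ C) : ‖T‖ ≤ C := by
  refine T.opNorm_le_bound hC fun x => ?_
  refine le_of_sq_le_sq ?_ (by positivity)
  rw [mul_pow, ← b.sum_sq_norm_inner_right, ← b.sum_sq_norm_inner_right x, Finset.mul_sum]
  refine Finset.sum_le_sum fun i _ => ?_
  rw [inner_eigenbasis_apply hb, norm_mul, mul_pow, Complex.norm_real, Real.norm_eq_abs]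
  gcongr
  exact hμ i

/-- The vector `∑ E_r w / (θ - θ_r)^k`, the sum ranging over the eigenvalues `θ_r ≠ θ`. -/
def resolventVector (b : OrthonormalBasis ι ℂ E) (μ : ι → ℝ) (θ : ℝ) (k : ℕ) (w : E) : E :=
  open Classical in
  ∑ i with μ i ≠ θ, (⟪b i, w⟫_ℂ / ((θ - μ i : ℝ) : ℂ) ^ k) • b i

open Classical in
theorem inner_resolventVector (b : OrthonormalBasis ι ℂ E) (μ : ι → ℝ) (θ : ℝ) (k : ℕ) (w : E)
    (i : ι) : ⟪b i, resolventVector b μ θ k w⟫_ℂ =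
      if μ i ≠ θ then ⟪b i, w⟫_ℂ / ((θ - μ i : ℝ) : ℂ) ^ k else 0 := by
  simp only [resolventVector, inner_sum, inner_smul_right, orthonormal_iff_ite.mp b.orthonormal,
    mul_ite, mul_one, mul_zero, Finset.sum_ite_eq, Finset.mem_filter, Finset.mem_univ, true_and]

/-- The resolvent identity `(θ - T) R = 1` off the eigenspace of `θ`, one power at a time; it
replaces any explicit operator `R`. -/
theorem apply_resolventVector {T : E →L[ℂ] E} {b : OrthonormalBasis ι ℂ E}
    {μ : ι → ℝ} (hb : ∀ i, T (b i) = (μ i : ℂ) • b i) (θ : ℝ) (k : ℕ) (w : E) :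
    T (resolventVector b μ θ (k + 1) w) =
      (θ : ℂ) • resolventVector b μ θ (k + 1) w - resolventVector b μ θ k w := by
  refine eigenbasis_ext b fun i => ?_
  rw [inner_eigenbasis_apply hb, inner_sub_right, inner_smul_right, inner_resolventVector,
    inner_resolventVector]
  by_cases h : μ i = θ
  · simp [h]
  · have h' : ((θ - μ i : ℝ) : ℂ) ≠ 0 := by exact_mod_cast sub_ne_zero.mpr (Ne.symm h)
    simp only [h, ne_eq, not_false_eq_true, if_true]
    field_simp
    push_cast
    ring

open Classical in
theorem inner_self_resolventVector (b : OrthonormalBasis ι ℂ E) (μ : ι → ℝ) (θ : ℝ) (k : ℕ)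
    (w : E) : ⟪w, resolventVector b μ θ k w⟫_ℂ =
      ((∑ i with μ i ≠ θ, ‖⟪b i, w⟫_ℂ‖ ^ 2 / (θ - μ i) ^ k : ℝ) : ℂ) := by
  rw [← b.sum_inner_mul_inner, Finset.sum_filter]
  push_cast
  refine Finset.sum_congr rfl fun i _ => ?_
  rw [inner_resolventVector]
  split_ifs
  · rw [← inner_conj_symm w, mul_div_assoc', mul_comm, Complex.mul_conj']
    push_cast
    rfl
  · simp

open Classical in
theorem norm_sq_resolventVector (b : OrthonormalBasis ι ℂ E) (μ : ι → ℝ) (θ : ℝ) (k : ℕ)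
    (w : E) : ‖resolventVector b μ θ k w‖ ^ 2 =
      ∑ i with μ i ≠ θ, ‖⟪b i, w⟫_ℂ‖ ^ 2 / (θ - μ i) ^ (2 * k) := by
  rw [← b.sum_sq_norm_inner_right, Finset.sum_filter]
  refine Finset.sum_congr rfl fun i _ => ?_
  rw [inner_resolventVector]
  split_ifs
  · rw [norm_div, norm_pow, Complex.norm_real, div_pow, ← pow_mul, mul_comm k, pow_mul,
      pow_mul, Real.norm_eq_abs, sq_abs]
  · simp

variable [FiniteDimensional ℂ E]

open Classical in
theorem inner_eigenProjection {T : E →L[ℂ] E} {b : OrthonormalBasis ι ℂ E}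
    {μ : ι → ℝ} (hb : ∀ i, T (b i) = (μ i : ℂ) • b i) (θ : ℝ) (i : ι) (x : E) :
    ⟪b i, eigenProjection T θ x⟫_ℂ = if μ i = θ then ⟪b i, x⟫_ℂ else 0 := by
  split_ifs with h
  · rw [eigenProjection, ← Submodule.inner_starProjection_left_eq_right,
      Submodule.starProjection_eq_self_iff.mpr]
    rw [← h]
    exact Module.End.mem_eigenspace_iff.mpr (hb i)
  · exact (mem_eigenspace_iff_inner_eigenbasis hb θ _).mp
      (Submodule.starProjection_apply_mem _ x) i h

open Classical in
theorem norm_sq_eigenProjection {T : E →L[ℂ] E} {b : OrthonormalBasis ι ℂ E}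
    {μ : ι → ℝ} (hb : ∀ i, T (b i) = (μ i : ℂ) • b i) (θ : ℝ) (x : E) :
    ‖eigenProjection T θ x‖ ^ 2 = ∑ i with μ i = θ, ‖⟪b i, x⟫_ℂ‖ ^ 2 := by
  rw [← b.sum_sq_norm_inner_right, Finset.sum_filter]
  refine Finset.sum_congr rfl fun i _ => ?_
  rw [inner_eigenProjection hb]
  split_ifs <;> simp

open Classical in
-- Grouping the basis indices by eigenvalue passes from distinct eigenvalues to a sum with
-- multiplicity, which can be computed.
theorem spectralMoment_eq_sum {T : E →L[ℂ] E} {b : OrthonormalBasis ι ℂ E}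
    {μ : ι → ℝ} (hb : ∀ i, T (b i) = (μ i : ℂ) • b i) (k : ℕ) (w : E) :
    spectralMoment T k w = ∑ i with μ i ≠ principalEigenvalue T,
      ‖⟪b i, w⟫_ℂ‖ ^ 2 / (principalEigenvalue T - μ i) ^ k := by
  have hset : eigenvalueSet T \ {principalEigenvalue T} =
      (((Finset.univ.image μ).erase (principalEigenvalue T) : Finset ℝ) : Set ℝ) := by
    rw [eigenvalueSet_eq_range hb]
    simp
  rw [spectralMoment, hset, finsum_mem_coe_finset,
    ← Finset.sum_fiberwise_of_maps_to (s := Finset.univ.filter (μ · ≠ principalEigenvalue T))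
      (t := (Finset.univ.image μ).erase (principalEigenvalue T)) (g := μ) (by simp)]
  refine Finset.sum_congr rfl fun θ hθ => ?_
  rw [norm_sq_eigenProjection hb, Finset.sum_div]
  refine Finset.sum_congr ?_ fun i hi => ?_
  · ext i
    simp only [Finset.mem_filter, Finset.mem_univ, true_and, Finset.mem_erase] at hθ ⊢
    exact ⟨fun h => ⟨h ▸ hθ.1, h⟩, fun h => h.2⟩
  · rw [(Finset.mem_filter.mp hi).2]

theorem eigenProjection_add_resolventVector {T : E →L[ℂ] E} {b : OrthonormalBasis ι ℂ E}
    {μ : ι → ℝ} (hb : ∀ i, T (b i) = (μ i : ℂ) • b i) (θ : ℝ) (w : E) :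
    eigenProjection T θ w + resolventVector b μ θ 0 w = w := by
  refine eigenbasis_ext b fun i => ?_
  rw [inner_add_right, inner_eigenProjection hb, inner_resolventVector]
  by_cases h : μ i = θ <;> simp [h]

end EigenBasis

/-! ### Unitary evolution, fidelity and the two-dimensional approximation. -/

section Dynamics

variable {E : Type*} [NormedAddCommGroup E] [InnerProductSpace ℂ E] [FiniteDimensional ℂ E]

theorem exp_I_smul_mem_unitary {M : E →L[ℂ] E} (hM : IsSelfAdjoint M) (t : ℝ) :
    NormedSpace.exp ((Complex.I * t) • M) ∈ unitary (E →L[ℂ] E) := by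
  let _ : NormedAlgebra ℚ (E →L[ℂ] E) := NormedAlgebra.restrictScalars ℚ ℂ _
  refine NormedSpace.exp_mem_unitary_of_mem_skewAdjoint ?_
  rw [skewAdjoint.mem_iff, star_smul, hM.star_eq]
  simp

theorem star_exp_I_smul {M : E →L[ℂ] E} (hM : IsSelfAdjoint M) (t : ℝ) :
    star (NormedSpace.exp ((Complex.I * t) • M)) = NormedSpace.exp ((-(Complex.I * t)) • M) := by
  rw [NormedSpace.star_exp, star_smul, hM.star_eq]
  simp

theorem norm_exp_I_smul_apply {M : E →L[ℂ] E} (hM : IsSelfAdjoint M) (t : ℝ) (x : E) :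
    ‖NormedSpace.exp ((Complex.I * t) • M) x‖ = ‖x‖ :=
  ((ContinuousLinearMap.inner_map_map_iff_adjoint_comp_self _).mpr
    (Unitary.mem_iff.mp (exp_I_smul_mem_unitary hM t)).1 |> fun h => by
    have := h x x
    rw [inner_self_eq_norm_sq_to_K, inner_self_eq_norm_sq_to_K] at this
    have h2 : ‖NormedSpace.exp ((Complex.I * t) • M) x‖ ^ 2 = ‖x‖ ^ 2 := by exact_mod_cast this
    exact (sq_eq_sq₀ (norm_nonneg _) (norm_nonneg _)).mp h2)

theorem hasDerivAt_exp_I_smul (M : E →L[ℂ] E) (t : ℝ) :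
    HasDerivAt (fun t : ℝ => NormedSpace.exp ((Complex.I * t) • M))
      (NormedSpace.exp ((Complex.I * t) • M) * (Complex.I • M)) t := by
  have h := (hasDerivAt_exp_smul_const (𝕂 := ℂ) (Complex.I • M) (t : ℂ)).scomp t
    (Complex.ofRealCLM.hasDerivAt (x := t))
  simpa [Function.comp_def, smul_smul, mul_comm] using h

/-- An approximate solution of the Schrödinger equation is close to the exact one. -/
theorem norm_exp_apply_sub_le {M : E →L[ℂ] E} (hM : IsSelfAdjoint M) {y y' : ℝ → E} {δ : ℝ}
    (hy : ∀ t, HasDerivAt y (y' t) t) (hδ : ∀ t, ‖y' t + Complex.I • M (y t)‖ ≤ δ)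
    {τ : ℝ} (hτ : 0 ≤ τ) :
    ‖NormedSpace.exp ((Complex.I * τ) • M) (y τ) - y 0‖ ≤ δ * τ := by
  -- Duhamel: undo the exact evolution on `y`. The derivative is a unitary applied to the residual,
  -- so it has norm at most `δ`.
  have hd : ∀ t : ℝ, HasDerivAt (fun t : ℝ => NormedSpace.exp ((Complex.I * t) • M) (y t))
      (NormedSpace.exp ((Complex.I * t) • M) (y' t + Complex.I • M (y t))) t := by
    intro t
    have h := ((ContinuousLinearMap.apply ℂ E).isBoundedBilinearMap.hasFDerivAt
      ((y t, NormedSpace.exp ((Complex.I * t) • M)))).restrictScalars ℝ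
    have h2 := h.comp_hasDerivAt t ((hy t).prodMk (hasDerivAt_exp_I_smul M t))
    refine h2.congr_deriv ?_
    simp [IsBoundedBilinearMap.deriv, add_comm]
  have := norm_image_sub_le_of_norm_deriv_le_segment'
    (f := fun t : ℝ => NormedSpace.exp ((Complex.I * t) • M) (y t)) (a := 0) (b := τ) (C := δ)
    (fun t _ => (hd t).hasDerivWithinAt)
    (fun t _ => by rw [norm_exp_I_smul_apply hM]; exact hδ t) τ ⟨hτ, le_rfl⟩
  simpa using this

theorem isSelfAdjoint_searchHamiltonian {T : E →L[ℂ] E} (hT : IsSelfAdjoint T) (γ : ℝ) (w : E) :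
    IsSelfAdjoint (searchHamiltonian T γ w) := by
  refine IsSelfAdjoint.add ?_ ?_
  · rw [IsSelfAdjoint, star_smul, hT.star_eq]
    simp
  · rw [ContinuousLinearMap.isSelfAdjoint_iff_isSymmetric]
    exact InnerProductSpace.isSymmetric_rankOne_self w

/-- Cyclicity of the trace turns the fidelity into an expectation of `E₁`, which is a self-adjoint
idempotent. -/
theorem fidelity_eq_norm_sq {T : E →L[ℂ] E} (hT : IsSelfAdjoint T) (γ : ℝ) (w : E) (t : ℝ) :
    fidelity T γ w t = ‖principalProjection T
      (NormedSpace.exp ((Complex.I * t) • searchHamiltonian T γ w) w)‖ ^ 2 := by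
  set V := NormedSpace.exp ((Complex.I * t) • searchHamiltonian T γ w) with hV
  have hstar : NormedSpace.exp ((-(Complex.I * t)) • searchHamiltonian T γ w) = star V :=
    (star_exp_I_smul (isSelfAdjoint_searchHamiltonian hT γ w) t).symm
  have htr : LinearMap.trace ℂ E
      ((InnerProductSpace.rankOne ℂ w w * density T γ w t : E →L[ℂ] E) : E →ₗ[ℂ] E) =
      ⟪V w, principalProjection T (V w)⟫_ℂ := by
    have h1 : ((InnerProductSpace.rankOne ℂ w w * density T γ w t : E →L[ℂ] E) : E →ₗ[ℂ] E) =
      ((InnerProductSpace.rankOne ℂ w w : E →L[ℂ] E) : E →ₗ[ℂ] E) *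
        ((density T γ w t : E →L[ℂ] E) : E →ₗ[ℂ] E) := rfl
    have h2 : ((density T γ w t : E →L[ℂ] E) : E →ₗ[ℂ] E) *
        ((InnerProductSpace.rankOne ℂ w w : E →L[ℂ] E) : E →ₗ[ℂ] E) =
        ((InnerProductSpace.rankOne ℂ (density T γ w t w) w : E →L[ℂ] E) : E →ₗ[ℂ] E) := by
      ext x
      simp [InnerProductSpace.rankOne_apply]
    rw [h1, LinearMap.trace_mul_comm, h2, InnerProductSpace.trace_rankOne, density, hstar, ← hV]
    simp only [mul_apply_eq_comp, ContinuousLinearMap.star_eq_adjoint]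
    rw [ContinuousLinearMap.adjoint_inner_right]
  have hP : ⟪V w, principalProjection T (V w)⟫_ℂ =
      ((‖principalProjection T (V w)‖ ^ 2 : ℝ) : ℂ) := by
    have h := Submodule.inner_starProjection_left_eq_right
      (Module.End.eigenspace (T : E →ₗ[ℂ] E) (principalEigenvalue T : ℂ)) (V w)
      (principalProjection T (V w))
    have hid : principalProjection T (principalProjection T (V w)) = principalProjection T (V w) :=
      Submodule.starProjection_eq_self_iff.mpr (Submodule.starProjection_apply_mem _ _)
    change ⟪principalProjection T (V w), _⟫_ℂ = ⟪V w, principalProjection T _⟫_ℂ at h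
    rw [hid] at h
    rw [← h, inner_self_eq_norm_sq_to_K]
    norm_cast
  rw [fidelity, htr, hP, Complex.ofReal_re]

/-- By Cauchy–Schwarz, one unit vector of the principal eigenspace suffices as a test vector. -/
theorem sq_le_fidelity {T : E →L[ℂ] E} (hT : IsSelfAdjoint T) {γ : ℝ} {w ψ : E} {t : ℝ}
    (hψ : principalProjection T ψ = ψ) (hψ₁ : ‖ψ‖ = 1) :
    ‖⟪NormedSpace.exp ((Complex.I * t) • searchHamiltonian T γ w) w, ψ⟫_ℂ‖ ^ 2 ≤
      fidelity T γ w t := by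
  rw [fidelity_eq_norm_sq hT]
  gcongr
  conv_lhs => rw [← hψ]
  rw [principalProjection, eigenProjection, ← Submodule.inner_starProjection_left_eq_right]
  simpa [hψ₁] using norm_inner_le_norm (𝕜 := ℂ) ((Module.End.eigenspace (T : E →ₗ[ℂ] E)
    (principalEigenvalue T : ℂ)).starProjection
      (NormedSpace.exp ((Complex.I * t) • searchHamiltonian T γ w) w)) ψ

/-- Lower bound for the fidelity at the critical scaling `γ = ⟨w, φ⟩ = S₁`, where `φ` and `χ` are the images of
`w - ε ψ` under the first two powers of the reduced resolvent of `T` at `θ`. -/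
theorem le_fidelity_of_resolvent {T : E →L[ℂ] E} (hT : IsSelfAdjoint T) {w ψ φ χ : E}
    {θ ε S r : ℝ} (hψ : principalProjection T ψ = ψ) (hψ₁ : ‖ψ‖ = 1) (hw : ‖w‖ ≤ 1)
    (hTψ : T ψ = (θ : ℂ) • ψ) (hTφ : T φ = (θ : ℂ) • φ - (w - (ε : ℂ) • ψ))
    (hTχ : T χ = (θ : ℂ) • χ - φ) (hwψ : ⟪w, ψ⟫_ℂ = ε) (hwφ : ⟪w, φ⟫_ℂ = S)
    (hwχ : ⟪w, χ⟫_ℂ = (r ^ 2 : ℝ)) (hε : 0 < ε) (hS : 0 < S) (hr : 0 < r)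
    (hpos : 0 ≤ S / r - (1 + Real.pi / 2) * (ε * ‖χ‖ / r ^ 2)) :
    (S / r - (1 + Real.pi / 2) * (ε * ‖χ‖ / r ^ 2)) ^ 2 ≤
      fidelity T S w (Real.pi * r / (2 * ε * S)) := by
  set M := searchHamiltonian T S w with hMdef
  have hM : IsSelfAdjoint M := isSelfAdjoint_searchHamiltonian hT S w
  set τ := Real.pi * r / (2 * ε * S) with hτ
  have hτ₀ : 0 ≤ τ := by positivity
  have hMψ : M ψ = ((S * θ : ℝ) : ℂ) • ψ + (ε : ℂ) • w := by
    simp only [hMdef, searchHamiltonian, add_apply,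
      smul_apply, InnerProductSpace.rankOne_apply, hTψ, hwψ]
    push_cast
    module
  -- This is where `γ = S` matters: the term `-S w` from `S T φ` cancels `⟪w, φ⟫ w = S w`.
  have hMφ : M φ = ((S * θ : ℝ) : ℂ) • φ + ((S * ε : ℝ) : ℂ) • ψ := by
    simp only [hMdef, searchHamiltonian, add_apply,
      smul_apply, InnerProductSpace.rankOne_apply, hTφ, hwφ]
    push_cast
    module
  have hMχ : M χ = ((S * θ : ℝ) : ℂ) • χ - (S : ℂ) • φ + ((r ^ 2 : ℝ) : ℂ) • w := by
    simp only [hMdef, searchHamiltonian, add_apply,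
      smul_apply, InnerProductSpace.rankOne_apply, hTχ, hwχ]
    push_cast
    module
  have hrC : (r : ℂ) ≠ 0 := by exact_mod_cast hr.ne'
  -- The coefficient is chosen so that the `ε w` in `M ψ` cancels the `r² w` in `M χ`.
  set ψ' := ψ - ((ε / r ^ 2 : ℝ) : ℂ) • χ with hψ'
  set ω := ε * S / r with hω
  let p : ℝ → ℂ := fun t => Complex.exp (-(Complex.I * (S * θ) * t))
  have hp : ∀ t, HasDerivAt p (-(Complex.I * (S * θ)) * p t) t := by
    intro t
    have h := (((hasDerivAt_id (t : ℂ)).const_mul (-(Complex.I * (S * θ)))).cexp).comp_ofReal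
    simp only [id, mul_one] at h
    refine (h.congr_deriv (by simp only [p]; ring_nf)).congr_of_eventuallyEq ?_
    exact Eventually.of_forall fun u => by simp only [p]; ring_nf
  have hp₁ : ∀ t, ‖p t‖ = 1 := by
    intro t
    simp [p, Complex.norm_exp]
  have hc : ∀ t : ℝ, HasDerivAt (fun t : ℝ => ((Real.cos (ω * t) : ℝ) : ℂ))
      ((-Real.sin (ω * t) * ω : ℝ) : ℂ) t := fun t => by
    simpa using (((hasDerivAt_id t).const_mul ω).cos).ofReal_comp
  have hs : ∀ t : ℝ, HasDerivAt (fun t : ℝ => ((Real.sin (ω * t) : ℝ) : ℂ))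
      ((Real.cos (ω * t) * ω : ℝ) : ℂ) t := fun t => by
    simpa using (((hasDerivAt_id t).const_mul ω).sin).ofReal_comp
  -- Exact solution of the model in which `ψ'` and `φ / r` are coupled with strength `ω`; `p`
  -- carries the common energy `S θ`.
  let y : ℝ → E := fun t => (p t * (Real.cos (ω * t) : ℝ)) • ψ' +
    (-(Complex.I / r) * (p t * (Real.sin (ω * t) : ℝ))) • φ
  have hy : ∀ t, HasDerivAt y
      ((-(Complex.I * (S * θ)) * p t * (Real.cos (ω * t) : ℝ) +
          p t * (-Real.sin (ω * t) * ω : ℝ)) • ψ' +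
        (-(Complex.I / r) * (-(Complex.I * (S * θ)) * p t * (Real.sin (ω * t) : ℝ) +
          p t * (Real.cos (ω * t) * ω : ℝ))) • φ) t := fun t =>
    (((hp t).mul (hc t)).smul_const ψ').add
      ((((hp t).mul (hs t)).const_mul (-(Complex.I / r))).smul_const φ)
  have hres := norm_exp_apply_sub_le hM hy (δ := S * ε ^ 2 * ‖χ‖ / r ^ 3) (fun t => by
    have hMψ' : M ψ' = ((S * θ : ℝ) : ℂ) • ψ' + ((ε * S / r ^ 2 : ℝ) : ℂ) • φ := by
      rw [hψ', map_sub, map_smul, hMψ, hMχ]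
      push_cast
      match_scalars <;> field_simp <;> ring
    have hMφ' : M φ = ((S * θ : ℝ) : ℂ) • φ + ((S * ε : ℝ) : ℂ) • ψ' +
        ((S * ε ^ 2 / r ^ 2 : ℝ) : ℂ) • χ := by
      rw [hMφ, hψ']
      push_cast
      match_scalars <;> field_simp <;> ring
    -- The residual comes only from the `χ` component of `M φ`, so it carries the factor `ε²`.
    have heq : (-(Complex.I * (S * θ)) * p t * (Real.cos (ω * t) : ℝ) +
          p t * (-Real.sin (ω * t) * ω : ℝ)) • ψ' +
        (-(Complex.I / r) * (-(Complex.I * (S * θ)) * p t * (Real.sin (ω * t) : ℝ) +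
          p t * (Real.cos (ω * t) * ω : ℝ))) • φ + Complex.I • M (y t) =
        (p t * ((Real.sin (ω * t) * (S * ε ^ 2 / r ^ 3) : ℝ) : ℂ)) • χ := by
      simp only [y]
      rw [map_add, map_smul, map_smul, hMψ', hMφ', hω]
      generalize ((Real.sin (ε * S / r * t) : ℝ)) = sn
      generalize ((Real.cos (ε * S / r * t) : ℝ)) = cs
      push_cast
      match_scalars <;> field_simp <;> ring_nf <;> simp
    rw [heq, norm_smul, norm_mul, hp₁, one_mul, Complex.norm_real, Real.norm_eq_abs, abs_mul,
      abs_of_pos (show 0 < S * ε ^ 2 / r ^ 3 by positivity)]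
    calc |Real.sin (ω * t)| * (S * ε ^ 2 / r ^ 3) * ‖χ‖
        ≤ 1 * (S * ε ^ 2 / r ^ 3) * ‖χ‖ := by gcongr; exact Real.abs_sin_le_one _
      _ = S * ε ^ 2 * ‖χ‖ / r ^ 3 := by ring) hτ₀
  have hωτ : ω * τ = Real.pi / 2 := by rw [hω, hτ]; field_simp
  have hyτ : y τ = (-(Complex.I / r) * p τ) • φ := by
    simp only [y, hωτ, Real.cos_pi_div_two, Real.sin_pi_div_two]
    simp
  have hy0 : y 0 = ψ - ((ε / r ^ 2 : ℝ) : ℂ) • χ := by simp [y, p, hψ']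
  have hδτ : S * ε ^ 2 * ‖χ‖ / r ^ 3 * τ = Real.pi / 2 * (ε * ‖χ‖ / r ^ 2) := by
    rw [hτ]; field_simp
  rw [hδτ, hyτ, hy0] at hres
  set V := NormedSpace.exp ((Complex.I * τ) • M) with hV
  -- The summand `π / 2` is the residual integrated up to `τ`; the `1` is the distance from `ψ'` to
  -- `ψ`.
  have hclose : ‖V ((-(Complex.I / r) * p τ) • φ) - ψ‖ ≤
      (1 + Real.pi / 2) * (ε * ‖χ‖ / r ^ 2) := by
    have hsplit : V ((-(Complex.I / r) * p τ) • φ) - ψ =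
        (V ((-(Complex.I / r) * p τ) • φ) - (ψ - ((ε / r ^ 2 : ℝ) : ℂ) • χ)) -
          ((ε / r ^ 2 : ℝ) : ℂ) • χ := by abel
    have hn : ‖((ε / r ^ 2 : ℝ) : ℂ) • χ‖ = ε * ‖χ‖ / r ^ 2 := by
      rw [norm_smul, Complex.norm_real, Real.norm_eq_abs, abs_of_pos (by positivity)]
      ring
    rw [hsplit]
    refine (norm_sub_le _ _).trans ?_
    rw [hn]
    linarith
  have hVV : ∀ x, ⟪V w, V x⟫_ℂ = ⟪w, x⟫_ℂ :=
    (ContinuousLinearMap.inner_map_map_iff_adjoint_comp_self _).mpr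
      (Unitary.mem_iff.mp (exp_I_smul_mem_unitary hM τ)).1 w
  have hVw : ‖V w‖ ≤ 1 := (norm_exp_I_smul_apply hM τ w).le.trans hw
  have hmain : ‖⟪V w, V ((-(Complex.I / r) * p τ) • φ)⟫_ℂ‖ = S / r := by
    rw [hVV, inner_smul_right, hwφ]
    simp [hp₁, abs_of_pos hr, abs_of_pos hS]
    ring
  refine le_trans ?_ (sq_le_fidelity hT hψ hψ₁)
  gcongr
  have h1 : ‖⟪V w, V ((-(Complex.I / r) * p τ) • φ)⟫_ℂ‖ ≤ ‖⟪V w, ψ⟫_ℂ‖ +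
      ‖⟪V w, V ((-(Complex.I / r) * p τ) • φ) - ψ⟫_ℂ‖ := by
    rw [inner_sub_right]
    refine le_trans (le_of_eq ?_) (norm_add_le _ _)
    congr 1
    ring
  have h2 : ‖⟪V w, V ((-(Complex.I / r) * p τ) • φ) - ψ⟫_ℂ‖ ≤
      (1 + Real.pi / 2) * (ε * ‖χ‖ / r ^ 2) := by
    refine (norm_inner_le_norm _ _).trans ?_
    refine (mul_le_mul_of_nonneg_right hVw (norm_nonneg _)).trans ?_
    rwa [one_mul]
  rw [hmain] at h1
  linarith

end Dynamics

/-! ### The fidelity bound in terms of spectral moments and the gap. -/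

section Fidelity

variable {E : Type*} [NormedAddCommGroup E] [InnerProductSpace ℂ E] [FiniteDimensional ℂ E]
  {ι : Type*} [Fintype ι] {T : E →L[ℂ] E} {b : OrthonormalBasis ι ℂ E} {μ : ι → ℝ}

/-- Cauchy–Schwarz, with one factor of each term left over to be bounded by `‖w‖ ≤ 1`. -/
theorem spectralMoment_one_sq_le (hb : ∀ i, T (b i) = (μ i : ℂ) • b i) {w : E} (hw : ‖w‖ ≤ 1) :
    spectralMoment T 1 w ^ 2 ≤ spectralMoment T 2 w := by
  classical
  rw [spectralMoment_eq_sum hb, spectralMoment_eq_sum hb]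
  set s : Finset ι := Finset.univ.filter (μ · ≠ principalEigenvalue T)
  have h := Finset.sum_mul_sq_le_sq_mul_sq s (fun i => ‖⟪b i, w⟫_ℂ‖)
    (fun i => ‖⟪b i, w⟫_ℂ‖ / (principalEigenvalue T - μ i))
  have h1 : ∑ i ∈ s, ‖⟪b i, w⟫_ℂ‖ ^ 2 ≤ 1 := by
    refine (Finset.sum_le_univ_sum_of_nonneg fun i => by positivity).trans ?_
    rw [b.sum_sq_norm_inner_right]
    exact pow_le_one₀ (norm_nonneg _) hw
  calc _ = (∑ i ∈ s, ‖⟪b i, w⟫_ℂ‖ * (‖⟪b i, w⟫_ℂ‖ / (principalEigenvalue T - μ i))) ^ 2 := by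
        congr 1
        exact Finset.sum_congr rfl fun i _ => by rw [pow_one]; ring
    _ ≤ _ := h
    _ ≤ 1 * ∑ i ∈ s, (‖⟪b i, w⟫_ℂ‖ / (principalEigenvalue T - μ i)) ^ 2 := by
        gcongr
    _ = _ := by
        rw [one_mul]
        exact Finset.sum_congr rfl fun i _ => by rw [div_pow]

/-- The squared norm is the fourth moment, and two of its four denominators are at least `D`. -/
theorem norm_resolventVector_two_le (hb : ∀ i, T (b i) = (μ i : ℂ) • b i) (w : E) {D : ℝ}
    (hD : 0 < D)
    (hgap : ∀ i, μ i ≠ principalEigenvalue T → D ≤ principalEigenvalue T - μ i) :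
    ‖resolventVector b μ (principalEigenvalue T) 2 w‖ ≤ √(spectralMoment T 2 w) / D := by
  classical
  rw [← Real.sqrt_sq hD.le, ← Real.sqrt_div' _ (sq_nonneg D)]
  refine Real.le_sqrt_of_sq_le ?_
  rw [norm_sq_resolventVector, spectralMoment_eq_sum hb, Finset.sum_div]
  refine Finset.sum_le_sum fun i hi => ?_
  have h := hgap i (Finset.mem_filter.mp hi).2
  have hpos : 0 < principalEigenvalue T - μ i := hD.trans_le h
  rw [div_div, show 2 * 2 = 2 + 2 from rfl, pow_add]
  gcongr

/-- At the scaling `γ = S₁` the search succeeds with amplitude at least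
`S₁ / √S₂ - (1 + π / 2) ε₁ / (D √S₂)`, where `D` is a lower bound for the spectral gap. -/
theorem le_fidelity_spectralMoment (hb : ∀ i, T (b i) = (μ i : ℂ) • b i) {w : E} (hw : ‖w‖ ≤ 1)
    (hε : shadow T w ≠ 0) {D : ℝ} (hD : 0 < D)
    (hgap : ∀ i, μ i ≠ principalEigenvalue T → D ≤ principalEigenvalue T - μ i)
    (hS : 0 < spectralMoment T 1 w)
    (hpos : 0 ≤ spectralMoment T 1 w / √(spectralMoment T 2 w) -
      (1 + Real.pi / 2) * (shadow T w / (D * √(spectralMoment T 2 w)))) :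
    (spectralMoment T 1 w / √(spectralMoment T 2 w) -
      (1 + Real.pi / 2) * (shadow T w / (D * √(spectralMoment T 2 w)))) ^ 2 ≤
    fidelity T (spectralMoment T 1 w) w
      (Real.pi * √(spectralMoment T 2 w) / (2 * shadow T w * spectralMoment T 1 w)) := by
  classical
  set θ := principalEigenvalue T with hθ
  set ε := shadow T w with hεdef
  have hε₀ : 0 < ε := lt_of_le_of_ne (norm_nonneg _) (Ne.symm hε)
  have hεC : (ε : ℂ) ≠ 0 := by exact_mod_cast hε₀.ne'
  have hS2 : 0 < spectralMoment T 2 w :=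
    (pow_pos hS 2).trans_le (spectralMoment_one_sq_le hb hw)
  set r := √(spectralMoment T 2 w) with hr
  have hr₀ : 0 < r := Real.sqrt_pos.mpr hS2
  have hr2 : r ^ 2 = spectralMoment T 2 w := Real.sq_sqrt hS2.le
  set ψ : E := ((ε⁻¹ : ℝ) : ℂ) • principalProjection T w with hψ
  have hψmem : principalProjection T w ∈ Module.End.eigenspace (T : E →ₗ[ℂ] E) (θ : ℂ) :=
    Submodule.starProjection_apply_mem _ _
  have hidem : principalProjection T (principalProjection T w) = principalProjection T w :=
    Submodule.starProjection_eq_self_iff.mpr hψmem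
  have hεψ : (ε : ℂ) • ψ = principalProjection T w := by
    rw [hψ, smul_smul]
    push_cast
    rw [mul_inv_cancel₀ hεC, one_smul]
  have hinner : ⟪w, principalProjection T w⟫_ℂ = ((ε ^ 2 : ℝ) : ℂ) := by
    have h := Submodule.inner_starProjection_left_eq_right
      (Module.End.eigenspace (T : E →ₗ[ℂ] E) (θ : ℂ)) w (principalProjection T w)
    change ⟪principalProjection T w, _⟫_ℂ = ⟪w, principalProjection T _⟫_ℂ at h
    rw [hidem] at h
    rw [← h, inner_self_eq_norm_sq_to_K]
    norm_cast
  have hsplit : resolventVector b μ θ 0 w = w - (ε : ℂ) • ψ := by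
    rw [hεψ, eq_sub_iff_add_eq']
    exact eigenProjection_add_resolventVector hb θ w
  have key := norm_resolventVector_two_le hb w hD hgap
  set χ := resolventVector b μ θ 2 w with hχ
  have hle : spectralMoment T 1 w / r - (1 + Real.pi / 2) * (ε / (D * r)) ≤
      spectralMoment T 1 w / r - (1 + Real.pi / 2) * (ε * ‖χ‖ / r ^ 2) := by
    have : ε * ‖χ‖ / r ^ 2 ≤ ε / (D * r) := by
      calc ε * ‖χ‖ / r ^ 2 ≤ ε * (r / D) / r ^ 2 := by gcongr
        _ = ε / (D * r) := by field_simp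
    gcongr
  refine (pow_le_pow_left₀ hpos hle 2).trans ?_
  refine le_fidelity_of_resolvent (isSelfAdjoint_of_eigenbasis hb) (ψ := ψ)
    (φ := resolventVector b μ θ 1 w) (θ := θ) ?_ ?_ hw ?_ ?_ ?_ ?_ ?_ ?_ hε₀ hS hr₀
    (hpos.trans hle)
  · rw [hψ, map_smul, hidem]
  · rw [hψ, norm_smul, Complex.norm_real, norm_inv, Real.norm_of_nonneg hε₀.le]
    exact inv_mul_cancel₀ hε₀.ne'
  · rw [hψ, map_smul, smul_comm]
    congr 1
    exact Module.End.mem_eigenspace_iff.mp hψmem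
  · rw [apply_resolventVector hb, hsplit]
  · exact apply_resolventVector hb θ 1 w
  · rw [hψ, inner_smul_right, hinner]
    push_cast
    field_simp
  · rw [inner_self_resolventVector, spectralMoment_eq_sum hb]
  · rw [inner_self_resolventVector, hr2, spectralMoment_eq_sum hb]

end Fidelity

/-! ### Characters diagonalize the Hamming graph. -/

section HammingSpectrum

variable {q n : ℕ}

theorem cast_hammingNorm_le (a : Fin n → ZMod q) : (hammingNorm a : ℝ) ≤ n := by
  have := hammingNorm_le_card_fintype (x := a)
  rw [Fintype.card_fin] at this
  exact_mod_cast this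

variable [NeZero q]

/-- The character of `(ℤ/qℤ)ⁿ` with index `a`. -/
def tupleCharacter (a x : Fin n → ZMod q) : ℂ :=
  ∏ i, ZMod.stdAddChar (a i * x i)

theorem tupleCharacter_add (a x y : Fin n → ZMod q) :
    tupleCharacter a (x + y) = tupleCharacter a x * tupleCharacter a y := by
  simp [tupleCharacter, mul_add, AddChar.map_add_eq_mul, Finset.prod_mul_distrib]

theorem norm_tupleCharacter (a x : Fin n → ZMod q) : ‖tupleCharacter a x‖ = 1 := by
  simp [tupleCharacter, norm_prod, AddChar.norm_apply]

theorem tupleCharacter_single (a : Fin n → ZMod q) (i : Fin n) (c : ZMod q) :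
    tupleCharacter a (Pi.single i c) = ZMod.stdAddChar (a i * c) := by
  rw [tupleCharacter, Finset.prod_eq_single i]
  · simp
  · intro j _ hj
    simp [hj]
  · simp

/-- The sum factors over the coordinates, and a coordinate where `a` and `b` differ contributes a
vanishing character sum. -/
theorem sum_conj_tupleCharacter_mul (a b : Fin n → ZMod q) :
    ∑ x, starRingEnd ℂ (tupleCharacter a x) * tupleCharacter b x =
      if a = b then (q : ℂ) ^ n else 0 := by
  have h : ∀ x, starRingEnd ℂ (tupleCharacter a x) * tupleCharacter b x =
      ∏ i, ZMod.stdAddChar (x i * (b i - a i)) := by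
    intro x
    rw [tupleCharacter, tupleCharacter, map_prod, ← Finset.prod_mul_distrib]
    refine Finset.prod_congr rfl fun i _ => ?_
    rw [← AddChar.map_neg_eq_conj, ← AddChar.map_add_eq_mul]
    congr 1
    ring
  simp only [h]
  rw [← Fintype.piFinset_univ, ← Finset.prod_univ_sum (fun _ => Finset.univ)
    (fun i c => (ZMod.stdAddChar (c * (b i - a i)) : ℂ))]
  simp only [AddChar.sum_mulShift _ (ZMod.isPrimitive_stdAddChar q), ZMod.card]
  split_ifs with hab
  · simp [hab]
  · obtain ⟨i, hi⟩ := Function.ne_iff.mp hab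
    exact Finset.prod_eq_zero (Finset.mem_univ i) (by simp [sub_eq_zero, hi.symm])

theorem orthonormal_tupleCharacter : Orthonormal ℂ fun a : Fin n → ZMod q =>
    (WithLp.toLp 2 fun x => ((√((q : ℝ) ^ n))⁻¹ : ℂ) * tupleCharacter a x :
      EuclideanSpace ℂ (Fin n → ZMod q)) := by
  have hq : (0 : ℝ) < (q : ℝ) ^ n := by
    have := NeZero.pos q
    positivity
  rw [orthonormal_iff_ite]
  intro a b
  have h := sum_conj_tupleCharacter_mul a b
  have hsq : ((√((q : ℝ) ^ n) : ℝ) : ℂ) * ((√((q : ℝ) ^ n) : ℝ) : ℂ) = (q : ℂ) ^ n := by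
    rw [← Complex.ofReal_mul, Real.mul_self_sqrt hq.le]
    push_cast
    rfl
  have hqC : (q : ℂ) ^ n ≠ 0 := by exact_mod_cast hq.ne'
  calc _ = ((√((q : ℝ) ^ n) : ℝ) : ℂ)⁻¹ * ((√((q : ℝ) ^ n) : ℝ) : ℂ)⁻¹ *
        ∑ x, starRingEnd ℂ (tupleCharacter a x) * tupleCharacter b x := by
        rw [PiLp.inner_apply, Finset.mul_sum]
        refine Finset.sum_congr rfl fun x _ => ?_
        simp
        ring
    _ = if a = b then 1 else 0 := by
        rw [h, ← mul_inv, hsq]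
        split_ifs <;> simp [hqC]

variable (q n) in
/-- The characters of `(ℤ/qℤ)ⁿ` as an orthonormal basis. -/
def characterBasis :
    OrthonormalBasis (Fin n → ZMod q) ℂ (EuclideanSpace ℂ (Fin n → ZMod q)) :=
  (basisOfOrthonormalOfCardEqFinrank (orthonormal_tupleCharacter (q := q) (n := n))
    (by simp)).toOrthonormalBasis (by
      rw [coe_basisOfOrthonormalOfCardEqFinrank]
      exact orthonormal_tupleCharacter)

theorem characterBasis_apply (a x : Fin n → ZMod q) :
    characterBasis q n a x = ((√((q : ℝ) ^ n))⁻¹ : ℂ) * tupleCharacter a x := by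
  simp [characterBasis]

theorem norm_sq_inner_characterBasis_vertexVector (a v : Fin n → ZMod q) :
    ‖⟪characterBasis q n a, vertexVector v⟫_ℂ‖ ^ 2 = ((q : ℝ) ^ n)⁻¹ := by
  rw [vertexVector, EuclideanSpace.inner_single_right, characterBasis_apply]
  simp [norm_tupleCharacter]

theorem sum_hammingNorm_eq_one {M : Type*} [AddCommMonoid M] (f : (Fin n → ZMod q) → M) :
    ∑ z with hammingNorm z = 1, f z = ∑ i, ∑ c with c ≠ 0, f (Pi.single i c) := by
  rw [Finset.sum_sigma']
  symm
  refine Finset.sum_bij (fun p _ => Pi.single p.1 p.2) ?_ ?_ ?_ ?_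
  · rintro ⟨i, c⟩ hp
    simp only [Finset.mem_sigma, Finset.mem_univ, Finset.mem_filter, true_and] at hp ⊢
    rw [hammingNorm, Finset.card_eq_one]
    refine ⟨i, ?_⟩
    ext j
    by_cases hj : j = i
    · subst hj; simp [hp]
    · simp [hj]
  · rintro ⟨i, c⟩ hp ⟨j, d⟩ hp' h
    simp only [Finset.mem_sigma, Finset.mem_univ, Finset.mem_filter, true_and] at hp hp' h
    have hij : i = j := by
      by_contra hij
      have := congrFun h i
      simp [hij] at this
      exact hp this
    subst hij
    have := congrFun h i
    simp only [Pi.single_eq_same] at this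
    rw [this]
  · intro z hz
    simp only [Finset.mem_filter, Finset.mem_univ, true_and] at hz
    rw [hammingNorm, Finset.card_eq_one] at hz
    obtain ⟨i, hi⟩ := hz
    have hz' : ∀ j, z j ≠ 0 ↔ j = i := fun j => by
      have := Finset.ext_iff.mp hi j
      simpa using this
    refine ⟨⟨i, z i⟩, by simpa using (hz' i).mpr rfl, ?_⟩
    ext j
    by_cases hj : j = i
    · subst hj; simp
    · have : z j = 0 := by
        by_contra h
        exact hj ((hz' j).mp h)
      simp [hj, this]
  · intros; rfl

/-- Coordinate `i` contributes a character sum without the term at `0`: `q - 1` if `a i = 0`, and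
`-1` otherwise. -/
theorem sum_tupleCharacter_hammingNorm_eq_one (a : Fin n → ZMod q) :
    ∑ z with hammingNorm z = 1, tupleCharacter a z =
      ((n * (q - 1) - q * hammingNorm a : ℝ) : ℂ) := by
  rw [sum_hammingNorm_eq_one]
  have h : ∀ i, ∑ c with c ≠ 0, tupleCharacter a (Pi.single i c) =
      (if a i = 0 then (q : ℂ) else 0) - 1 := by
    intro i
    have h1 := AddChar.sum_mulShift (a i) (ZMod.isPrimitive_stdAddChar q)
    rw [← Finset.sum_filter_add_sum_filter_not Finset.univ (fun c : ZMod q => c ≠ 0)] at h1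
    simp only [ne_eq, not_not, Finset.filter_eq', Finset.mem_univ, if_true,
      Finset.sum_singleton, zero_mul, AddChar.map_zero_eq_one, ZMod.card] at h1
    simp only [tupleCharacter_single, mul_comm (a i)]
    rw [eq_sub_iff_add_eq, h1]
    split_ifs <;> simp
  simp only [h]
  have hcard : (hammingNorm a : ℂ) = ∑ i, if a i = 0 then 0 else 1 := by
    rw [hammingNorm, Finset.card_filter]
    push_cast
    exact Finset.sum_congr rfl fun i _ => by simp
  push_cast
  have hn : (n : ℂ) * (q - 1) = ∑ _i : Fin n, ((q : ℂ) - 1) := by simp [mul_sub]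
  rw [hcard, Finset.mul_sum, hn, ← Finset.sum_sub_distrib]
  refine Finset.sum_congr rfl fun i _ => ?_
  split_ifs <;> ring

/-- The graph is a Cayley graph with the tuples of weight one as connection set, so a character is
multiplied by its sum over that set. -/
theorem adjOperator_characterBasis (a : Fin n → ZMod q) :
    adjOperator (hammingGraph n q) (characterBasis q n a) =
      ((n * (q - 1) - q * hammingNorm a : ℝ) : ℂ) • characterBasis q n a := by
  ext x
  have h1 : (adjOperator (hammingGraph n q) (characterBasis q n a)) x =
      ∑ y, if hammingDist x y = 1 then characterBasis q n a y else 0 := by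
    rw [adjOperator, Matrix.ofLp_toEuclideanCLM]
    simp only [Matrix.mulVec, dotProduct, SimpleGraph.adjMatrix_apply, ite_mul, one_mul, zero_mul]
    rfl
  rw [h1, ← Equiv.sum_comp (Equiv.addLeft x), ← Finset.sum_filter]
  have hd : ∀ z, hammingDist x (Equiv.addLeft x z) = hammingNorm z := by
    intro z
    rw [hammingDist_comm, hammingDist_eq_hammingNorm]
    simp [hammingNorm]
  simp only [hd]
  simp only [Equiv.coe_addLeft, characterBasis_apply, tupleCharacter_add, ← mul_assoc]
  rw [← Finset.mul_sum, sum_tupleCharacter_hammingNorm_eq_one, PiLp.smul_apply,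
    characterBasis_apply, smul_eq_mul]
  ring

theorem norm_adjOperator_hammingGraph (hq : 2 ≤ q) :
    ‖adjOperator (hammingGraph n q)‖ = n * (q - 1) := by
  have hq' : (2 : ℝ) ≤ q := by exact_mod_cast hq
  have hn : (0 : ℝ) ≤ n := n.cast_nonneg
  have h0 : (0 : ℝ) ≤ n * (q - 1) := mul_nonneg hn (by linarith)
  refine le_antisymm (norm_apply_le_of_eigenbasis adjOperator_characterBasis h0 fun a => ?_) ?_
  -- The lower bound needs `q |a| ≤ 2 n (q - 1)`, which uses `q ≥ 2`.
  · have h1 := cast_hammingNorm_le a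
    have h2 : (0 : ℝ) ≤ hammingNorm a := Nat.cast_nonneg _
    rw [abs_le]
    constructor <;> nlinarith
  · have h := (adjOperator (hammingGraph n q)).le_opNorm (characterBasis q n 0)
    rw [adjOperator_characterBasis, norm_smul, (characterBasis q n).orthonormal.1] at h
    simp only [hammingNorm_zero, Nat.cast_zero, mul_zero, sub_zero, mul_one, Complex.norm_real,
      Real.norm_of_nonneg h0] at h
    exact h

variable (q) in
/-- The eigenvalue of the normalized adjacency operator at the character with index `a`. -/
def hammingEigenvalue (s : ℝ) (a : Fin n → ZMod q) : ℝ :=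
  s + (1 - s) / (n * (q - 1)) * (n * (q - 1) - q * hammingNorm a)

theorem hammingOperator_characterBasis (hq : 2 ≤ q) (s : ℝ) (a : Fin n → ZMod q) :
    hammingOperator q s n (characterBasis q n a) =
      (hammingEigenvalue q s a : ℂ) • characterBasis q n a := by
  simp only [hammingOperator, normalizedAdj, norm_adjOperator_hammingGraph hq, add_apply,
    smul_apply, one_apply_eq_self, adjOperator_characterBasis, hammingEigenvalue]
  push_cast
  module

end HammingSpectrum

/-! ### Gap, shadow and moment bounds for the Hamming graph. -/

section HammingMoments

variable {q n : ℕ}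

variable (q) in
/-- The constant `κ` for which the spectral gap of the normalized Hamming graph is `κ / n`. -/
def hammingGap (s : ℝ) : ℝ := (1 - s) * q / (q - 1)

theorem hammingGap_pos (hq : 2 ≤ q) {s : ℝ} (hs : s < 1) : 0 < hammingGap q s := by
  have hq' : (2 : ℝ) ≤ q := by exact_mod_cast hq
  exact div_pos (mul_pos (by linarith) (by linarith)) (by linarith)

theorem hammingEigenvalue_zero_sub (hq : 2 ≤ q) (s : ℝ) (a : Fin n → ZMod q) :
    hammingEigenvalue q s (0 : Fin n → ZMod q) - hammingEigenvalue q s a =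
      hammingGap q s * hammingNorm a / n := by
  have hq' : (q : ℝ) - 1 ≠ 0 := by
    have : (2 : ℝ) ≤ q := by exact_mod_cast hq
    linarith
  simp only [hammingEigenvalue, hammingGap, hammingNorm_zero, Nat.cast_zero]
  rcases eq_or_ne (n : ℝ) 0 with hn | hn
  · simp [hn]
  · field_simp
    ring

theorem hammingEigenvalue_zero (hq : 2 ≤ q) (hn : 1 ≤ n) (s : ℝ) :
    hammingEigenvalue q s (0 : Fin n → ZMod q) = 1 := by
  have hq' : (q : ℝ) - 1 ≠ 0 := by
    have : (2 : ℝ) ≤ q := by exact_mod_cast hq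
    linarith
  have hn' : (n : ℝ) ≠ 0 := by exact_mod_cast (by omega : n ≠ 0)
  simp only [hammingEigenvalue, hammingNorm_zero, Nat.cast_zero]
  field_simp
  ring

variable [NeZero q]

/-- Group the tuples by support: a support of size `j` carries `(q - 1) ^ j` of them. -/
theorem sum_hammingNorm_eq_sum_range (f : ℕ → ℝ) :
    ∑ a : Fin n → ZMod q, f (hammingNorm a) =
      ∑ j ∈ Finset.range (n + 1), n.choose j * ((q : ℝ) - 1) ^ j * f j := by
  have hfib : ∀ S : Finset (Fin n),
      ((Finset.univ.filter fun a : Fin n → ZMod q =>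
        (Finset.univ.filter fun i => a i ≠ 0) = S).card : ℝ) = ((q : ℝ) - 1) ^ S.card := by
    intro S
    have h : (Finset.univ.filter fun a : Fin n → ZMod q =>
        (Finset.univ.filter fun i => a i ≠ 0) = S) =
        Fintype.piFinset fun i => if i ∈ S then Finset.univ.erase (0 : ZMod q) else {0} := by
      ext a
      simp only [Finset.mem_filter, Finset.mem_univ, true_and, Fintype.mem_piFinset,
        Finset.ext_iff]
      refine forall_congr' fun i => ?_
      by_cases hi : i ∈ S <;> simp [hi]
    rw [h, Fintype.card_piFinset]
    simp only [apply_ite Finset.card, Finset.card_singleton,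
      Finset.card_erase_of_mem (Finset.mem_univ _), Finset.card_univ, ZMod.card,
      Finset.prod_ite_mem, Finset.univ_inter, Finset.prod_const]
    push_cast [Nat.cast_sub (NeZero.one_le (n := q))]
    rfl
  rw [← Finset.sum_fiberwise_of_maps_to (s := Finset.univ) (t := Finset.univ)
    (g := fun a : Fin n → ZMod q => (Finset.univ.filter fun i => a i ≠ 0)) (by simp)]
  have h2 : ∀ S : Finset (Fin n), ∑ a : Fin n → ZMod q with
      (Finset.univ.filter fun i => a i ≠ 0) = S, f (hammingNorm a) =
      ((q : ℝ) - 1) ^ S.card * f S.card := by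
    intro S
    rw [← hfib, ← nsmul_eq_mul]
    refine Finset.sum_eq_card_nsmul fun a ha => ?_
    rw [← (Finset.mem_filter.mp ha).2]
    rfl
  simp only [h2]
  rw [← Finset.powerset_univ,
    Finset.sum_powerset_apply_card (fun j => ((q : ℝ) - 1) ^ j * f j)]
  simp [mul_assoc]

/-- Dividing `n.choose j` by `(j + 1) (j + 2)` gives `(n + 2).choose (j + 2)` over `(n + 1) (n +
2)`, so the sum is part of the binomial expansion of `q ^ (n + 2)`. -/
theorem sum_inv_hammingNorm_le (hq : 2 ≤ q) :
    ∑ a : Fin n → ZMod q, (((hammingNorm a : ℝ) + 1) * (hammingNorm a + 2))⁻¹ ≤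
      (q : ℝ) ^ (n + 2) / ((n + 1) * (n + 2) * ((q : ℝ) - 1) ^ 2) := by
  have hq' : (0 : ℝ) < (q : ℝ) - 1 := by
    have : (2 : ℝ) ≤ q := by exact_mod_cast hq
    linarith
  rw [sum_hammingNorm_eq_sum_range (fun j => (((j : ℝ) + 1) * (j + 2))⁻¹),
    le_div_iff₀ (by positivity), Finset.sum_mul]
  have hterm : ∀ j ∈ Finset.range (n + 1), n.choose j * ((q : ℝ) - 1) ^ j *
      (((j : ℝ) + 1) * (j + 2))⁻¹ * ((n + 1) * (n + 2) * ((q : ℝ) - 1) ^ 2) =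
      ((q : ℝ) - 1) ^ (j + 2) * ((n + 2).choose (j + 2)) := by
    intro j _
    have h1 : ((n : ℝ) + 1) * n.choose j = (n + 1).choose (j + 1) * (j + 1) := by
      exact_mod_cast Nat.add_one_mul_choose_eq n j
    have h2 : ((n : ℝ) + 2) * (n + 1).choose (j + 1) = (n + 2).choose (j + 2) * (j + 2) := by
      exact_mod_cast Nat.add_one_mul_choose_eq (n + 1) (j + 1)
    have h3 : ((n : ℝ) + 1) * (n + 2) * n.choose j =
        (n + 2).choose (j + 2) * ((j + 1) * (j + 2)) := by
      linear_combination ((n : ℝ) + 2) * h1 + ((j : ℝ) + 1) * h2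
    have h4 : ((j : ℝ) + 1) * (j + 2) ≠ 0 := by positivity
    calc _ = (((n : ℝ) + 1) * (n + 2) * n.choose j) * (((j : ℝ) + 1) * (j + 2))⁻¹ *
          ((q : ℝ) - 1) ^ (j + 2) := by ring
      _ = _ := by rw [h3, mul_assoc _ (((j : ℝ) + 1) * (j + 2)), mul_inv_cancel₀ h4]; ring
  rw [Finset.sum_congr rfl hterm]
  have hbin := add_pow ((q : ℝ) - 1) 1 (n + 2)
  simp only [one_pow, mul_one, sub_add_cancel] at hbin
  rw [hbin, Finset.sum_range_succ' _ (n + 2), Finset.sum_range_succ' _ (n + 1)]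
  -- The two lowest terms of the expansion are discarded.
  have h0 : (0 : ℝ) ≤ ((q : ℝ) - 1) ^ (0 + 1) * ((n + 2).choose (0 + 1)) := by positivity
  have h1 : (0 : ℝ) ≤ ((q : ℝ) - 1) ^ 0 * ((n + 2).choose 0) := by positivity
  linarith

theorem principalEigenvalue_hammingOperator (hq : 2 ≤ q) {s : ℝ} (hs : s < 1) :
    principalEigenvalue (hammingOperator q s n) =
      hammingEigenvalue q s (0 : Fin n → ZMod q) := by
  refine principalEigenvalue_eq (hammingOperator_characterBasis hq s) fun a => ?_
  have h := hammingGap_pos hq hs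
  rw [← sub_nonneg, hammingEigenvalue_zero_sub hq]
  positivity

theorem hammingEigenvalue_eq_iff (hq : 2 ≤ q) {s : ℝ} (hs : s < 1) (a : Fin n → ZMod q) :
    hammingEigenvalue q s a = hammingEigenvalue q s (0 : Fin n → ZMod q) ↔ a = 0 := by
  refine ⟨fun h => ?_, fun h => by rw [h]⟩
  have h1 := hammingEigenvalue_zero_sub hq s a
  rw [h, sub_self] at h1
  rcases Nat.eq_zero_or_pos n with rfl | hn
  · exact Subsingleton.elim _ _
  · have hn' : (n : ℝ) ≠ 0 := by exact_mod_cast hn.ne'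
    have h2 := (hammingGap_pos hq hs).ne'
    have h3 := h1.symm
    simp only [div_eq_zero_iff, mul_eq_zero, h2, hn', false_or, or_false] at h3
    exact hammingNorm_eq_zero.mp (by exact_mod_cast h3)

theorem shadow_hammingOperator (hq : 2 ≤ q) {s : ℝ} (hs : s < 1) (v : Fin n → ZMod q) :
    shadow (hammingOperator q s n) (vertexVector v) = (√(q : ℝ))⁻¹ ^ n := by
  have h : shadow (hammingOperator q s n) (vertexVector v) ^ 2 = ((√(q : ℝ))⁻¹ ^ n) ^ 2 := by
    rw [shadow, principalProjection, norm_sq_eigenProjection (hammingOperator_characterBasis hq s)]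
    simp only [principalEigenvalue_hammingOperator hq hs, hammingEigenvalue_eq_iff hq hs,
      norm_sq_inner_characterBasis_vertexVector]
    rw [Finset.filter_eq' Finset.univ, if_pos (Finset.mem_univ _), Finset.sum_singleton,
      ← pow_mul, mul_comm n, pow_mul, inv_pow, Real.sq_sqrt q.cast_nonneg, inv_pow]
  exact (sq_eq_sq₀ (norm_nonneg _) (by positivity)).mp h

theorem spectralMoment_hammingOperator (hq : 2 ≤ q) {s : ℝ} (hs : s < 1) (k : ℕ)
    (v : Fin n → ZMod q) : spectralMoment (hammingOperator q s n) k (vertexVector v) =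
      ∑ a : Fin n → ZMod q with a ≠ 0,
        ((q : ℝ) ^ n)⁻¹ / (hammingGap q s * hammingNorm a / n) ^ k := by
  rw [spectralMoment_eq_sum (hammingOperator_characterBasis hq s)]
  simp only [principalEigenvalue_hammingOperator hq hs, ne_eq, hammingEigenvalue_eq_iff hq hs,
    norm_sq_inner_characterBasis_vertexVector, hammingEigenvalue_zero_sub hq]

/-- Weights are at most `n`, so every eigenvalue difference is at most `κ`; the nonzero characters
carry mass `1 - q⁻ⁿ ≥ 1 / 2`. -/
theorem le_spectralMoment_one_hammingOperator (hq : 2 ≤ q) {s : ℝ} (hs : s < 1) (hn : 1 ≤ n)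
    (v : Fin n → ZMod q) :
    (2 * hammingGap q s)⁻¹ ≤ spectralMoment (hammingOperator q s n) 1 (vertexVector v) := by
  have hκ := hammingGap_pos hq hs
  have hq' : (2 : ℝ) ≤ q := by exact_mod_cast hq
  have hn' : (0 : ℝ) < n := by exact_mod_cast hn
  have hqn : (2 : ℝ) ≤ (q : ℝ) ^ n :=
    hq'.trans (le_self_pow₀ (by linarith) (by omega))
  rw [spectralMoment_hammingOperator hq hs]
  calc (2 * hammingGap q s)⁻¹
      ≤ ((q : ℝ) ^ n - 1) * (((q : ℝ) ^ n)⁻¹ / hammingGap q s) := by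
        rw [sub_mul, mul_div_assoc', mul_inv_cancel₀ (by positivity), one_mul, mul_inv,
          div_eq_mul_inv, div_eq_mul_inv, one_mul, ← one_sub_mul]
        have : ((q : ℝ) ^ n)⁻¹ ≤ 2⁻¹ := inv_anti₀ (by norm_num) hqn
        gcongr
        linarith
    _ = ∑ a : Fin n → ZMod q with a ≠ 0, ((q : ℝ) ^ n)⁻¹ / hammingGap q s := by
        rw [Finset.sum_const, Finset.filter_ne', Finset.card_erase_of_mem (Finset.mem_univ _),
          Finset.card_univ, nsmul_eq_mul]
        simp only [Fintype.card_pi, ZMod.card, Finset.prod_const, Finset.card_univ,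
          Fintype.card_fin]
        rw [Nat.cast_sub (Nat.one_le_pow _ _ (by omega))]
        push_cast
        rfl
    _ ≤ _ := by
        refine Finset.sum_le_sum fun a ha => ?_
        have ha' : (0 : ℝ) < hammingNorm a := by
          exact_mod_cast hammingNorm_pos_iff.mpr (Finset.mem_filter.mp ha).2
        have h1 := cast_hammingNorm_le a
        rw [pow_one]
        gcongr
        rw [div_le_iff₀ hn']
        gcongr

theorem spectralMoment_two_hammingOperator_le (hq : 2 ≤ q) {s : ℝ} (hs : s < 1)
    (v : Fin n → ZMod q) :
    spectralMoment (hammingOperator q s n) 2 (vertexVector v) ≤ 24 / hammingGap q s ^ 2 := by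
  have hκ := hammingGap_pos hq hs
  have hq' : (2 : ℝ) ≤ q := by exact_mod_cast hq
  have hq1 : (0 : ℝ) < (q : ℝ) - 1 := by linarith
  have hn : (0 : ℝ) ≤ n := n.cast_nonneg
  rw [spectralMoment_hammingOperator hq hs]
  set c : ℝ := 6 * ((q : ℝ) ^ n)⁻¹ * n ^ 2 / hammingGap q s ^ 2 with hc
  calc _ ≤ ∑ a : Fin n → ZMod q with a ≠ 0,
        c * (((hammingNorm a : ℝ) + 1) * (hammingNorm a + 2))⁻¹ := by
        refine Finset.sum_le_sum fun a ha => ?_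
        have ha' : (1 : ℝ) ≤ hammingNorm a := by
          exact_mod_cast hammingNorm_pos_iff.mpr (Finset.mem_filter.mp ha).2
        have ha0 : (0 : ℝ) < hammingNorm a := by linarith
        -- The factor 6 is sharp at weight 1. The product on the right is the one that telescopes
        -- into binomial coefficients.
        have h1 : ((hammingNorm a : ℝ) ^ 2)⁻¹ ≤
            6 * (((hammingNorm a : ℝ) + 1) * (hammingNorm a + 2))⁻¹ := by
          rw [← div_eq_mul_inv, inv_le_comm₀ (by positivity) (by positivity), inv_div,
            div_le_iff₀ (by norm_num)]
          nlinarith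
        calc _ = ((q : ℝ) ^ n)⁻¹ * n ^ 2 / hammingGap q s ^ 2 * ((hammingNorm a : ℝ) ^ 2)⁻¹ := by
              rw [div_pow, mul_pow, div_div_eq_mul_div, div_mul_eq_div_div, div_eq_mul_inv _
                ((hammingNorm a : ℝ) ^ 2)]
          _ ≤ ((q : ℝ) ^ n)⁻¹ * n ^ 2 / hammingGap q s ^ 2 *
                (6 * (((hammingNorm a : ℝ) + 1) * (hammingNorm a + 2))⁻¹) := by gcongr
          _ = _ := by rw [hc]; ring
    _ ≤ ∑ a : Fin n → ZMod q, c * (((hammingNorm a : ℝ) + 1) * (hammingNorm a + 2))⁻¹ :=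
        Finset.sum_le_univ_sum_of_nonneg fun a => by positivity
    _ ≤ c * ((q : ℝ) ^ (n + 2) / ((n + 1) * (n + 2) * ((q : ℝ) - 1) ^ 2)) := by
        rw [← Finset.mul_sum]
        gcongr
        exact sum_inv_hammingNorm_le hq
    _ = 6 / hammingGap q s ^ 2 * (n ^ 2 / ((n + 1) * (n + 2))) * (q / ((q : ℝ) - 1)) ^ 2 := by
        rw [hc]
        field_simp
        ring
    _ ≤ 6 / hammingGap q s ^ 2 * 1 * 2 ^ 2 := by
        gcongr
        · rw [div_le_one (by positivity)]
          nlinarith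
        · rw [div_le_iff₀ hq1]
          linarith
    _ = _ := by ring

theorem spectralGap_hammingOperator (hq : 2 ≤ q) {s : ℝ} (hs : s < 1) (hn : 1 ≤ n) :
    spectralGap (hammingOperator q s n) = hammingGap q s / n := by
  have hκ := hammingGap_pos hq hs
  have hsub := fun a : Fin n → ZMod q => hammingEigenvalue_zero_sub hq s a
  have : Fact (1 < q) := ⟨by omega⟩
  -- A tuple of weight 1, the least nonzero weight, realizes the second eigenvalue.
  let e : Fin n → ZMod q := Pi.single ⟨0, hn⟩ 1
  have he : hammingNorm e = 1 := by
    rw [hammingNorm, Finset.card_eq_one]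
    refine ⟨⟨0, hn⟩, ?_⟩
    ext j
    by_cases hj : j = ⟨0, hn⟩
    · subst hj; simp [e]
    · simp [e, hj]
  have hsecond : secondEigenvalue (hammingOperator q s n) = hammingEigenvalue q s e := by
    rw [secondEigenvalue, principalEigenvalue_hammingOperator hq hs,
      eigenvalueSet_eq_range (hammingOperator_characterBasis hq s)]
    refine IsGreatest.csSup_eq ⟨⟨⟨e, rfl⟩, ?_⟩, ?_⟩
    · rw [Set.mem_singleton_iff, hammingEigenvalue_eq_iff hq hs, ← hammingNorm_eq_zero, he]
      norm_num
    · rintro _ ⟨⟨a, rfl⟩, ha⟩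
      rw [Set.mem_singleton_iff, hammingEigenvalue_eq_iff hq hs] at ha
      have h1 : (1 : ℝ) ≤ hammingNorm a := by exact_mod_cast hammingNorm_pos_iff.mpr ha
      have h2 : hammingGap q s * hammingNorm e / n ≤ hammingGap q s * hammingNorm a / n := by
        rw [he]
        gcongr
        simpa using h1
      rw [← hsub, ← hsub] at h2
      linarith
  rw [spectralGap, hsecond, principalEigenvalue_hammingOperator hq hs, hsub, he]
  simp

theorem isNormalized_hammingOperator (hq : 2 ≤ q) {s : ℝ} (hs : s < 1) (hn : 1 ≤ n) :
    IsNormalized (2 * s - 1) (hammingOperator q s n) := by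
  have hb := hammingOperator_characterBasis (n := n) hq s
  have hκ := hammingGap_pos hq hs
  have hq' : (2 : ℝ) ≤ q := by exact_mod_cast hq
  have hn' : (0 : ℝ) < n := by exact_mod_cast hn
  refine ⟨isSelfAdjoint_of_eigenbasis hb, ?_, ?_⟩
  · rw [eigenvalueSet_eq_range hb]
    rintro _ ⟨a, rfl⟩
    have h := hammingEigenvalue_zero_sub hq s a
    rw [hammingEigenvalue_zero hq hn] at h
    have h0 : 0 ≤ hammingGap q s * hammingNorm a / n := by positivity
    have h1 : hammingGap q s * hammingNorm a / n ≤ hammingGap q s := by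
      rw [div_le_iff₀ hn']
      gcongr
      exact_mod_cast cast_hammingNorm_le a
    -- This is `q / (q - 1) ≤ 2`; the eigenvalues are at least `1 - κ`.
    have h2 : hammingGap q s ≤ 2 * (1 - s) := by
      rw [hammingGap, div_le_iff₀ (by linarith)]
      nlinarith
    constructor <;> linarith
  · have h := finrank_eigenspace_eq_one hb (θ := 1) (i := 0) fun a => by
      rw [← hammingEigenvalue_zero hq hn s]
      exact hammingEigenvalue_eq_iff hq hs a
    simpa using h

end HammingMoments

/-! ### Optimal search and the asymptotic statements. -/

section HammingSearch

variable {q : ℕ}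

theorem tendsto_mul_inv_sqrt_pow (hq : 2 ≤ q) :
    Tendsto (fun n : ℕ => (n : ℝ) * (√(q : ℝ))⁻¹ ^ n) atTop (nhds 0) := by
  refine tendsto_self_mul_const_pow_of_lt_one (by positivity) (inv_lt_one_of_one_lt₀ ?_)
  rw [Real.lt_sqrt zero_le_one]
  have hq' : (2 : ℝ) ≤ q := by exact_mod_cast hq
  linarith

variable [NeZero q]

theorem norm_vertexVector {V : Type*} [Fintype V] [DecidableEq V] (v : V) :
    ‖vertexVector v‖ = 1 := by
  simp [vertexVector]

theorem sqrt_spectralMoment_two_hammingOperator_le (hq : 2 ≤ q) {s : ℝ} (hs : s < 1) {n : ℕ}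
    (v : Fin n → ZMod q) :
    √(spectralMoment (hammingOperator q s n) 2 (vertexVector v)) ≤ 5 / hammingGap q s := by
  have hκ := hammingGap_pos hq hs
  refine Real.sqrt_le_iff.mpr ⟨by positivity, ?_⟩
  refine (spectralMoment_two_hammingOperator_le hq hs v).trans ?_
  rw [div_pow]
  gcongr
  norm_num

theorem spectralMoment_one_le_sqrt_two_hammingOperator (hq : 2 ≤ q) (s : ℝ) {n : ℕ}
    (v : Fin n → ZMod q) :
    spectralMoment (hammingOperator q s n) 1 (vertexVector v) ≤
      √(spectralMoment (hammingOperator q s n) 2 (vertexVector v)) :=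
  Real.le_sqrt_of_sq_le
    (spectralMoment_one_sq_le (hammingOperator_characterBasis hq s) (norm_vertexVector v).le)

theorem isGroverianWith_spectralMoment_hammingOperator (hq : 2 ≤ q) {s : ℝ} (hs : s < 1) :
    IsGroverianWith (hammingOperator q s) (hammingTargets q)
      (fun n w => spectralMoment (hammingOperator q s n) 1 w) := by
  have hκ := hammingGap_pos hq hs
  -- With `n ε < 1 / 120` the loss is at most `3 * 2 n ε ≤ 1 / 20`, half of the lower bound `1 / 10`
  -- for `S₁ / √S₂`.
  have hev := (tendsto_mul_inv_sqrt_pow hq).eventually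
    (gt_mem_nhds (show (0 : ℝ) < 1 / 120 by norm_num))
  obtain ⟨N, hN⟩ := eventually_atTop.mp (hev.and (eventually_ge_atTop 1))
  -- The time constant bounds `π r / (2 S)`, using `π ≤ 4` and `r ≤ 10 S`.
  refine ⟨20, by norm_num, (1 / 20) ^ 2, by norm_num, N, fun n hn w hw hε => ?_⟩
  obtain ⟨hsmall, hn1⟩ := hN n hn
  obtain ⟨v, rfl⟩ := hw
  have hn' : (0 : ℝ) < n := by exact_mod_cast hn1
  have hS := le_spectralMoment_one_hammingOperator hq hs hn1 v
  have hS0 : 0 < spectralMoment (hammingOperator q s n) 1 (vertexVector v) :=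
    lt_of_lt_of_le (by positivity) hS
  have hSr := spectralMoment_one_le_sqrt_two_hammingOperator hq s v
  have hr := sqrt_spectralMoment_two_hammingOperator_le hq hs v
  have hr0 := hS0.trans_le hSr
  have hε0 : 0 < shadow (hammingOperator q s n) (vertexVector v) :=
    lt_of_le_of_ne (norm_nonneg _) (Ne.symm hε)
  rw [← shadow_hammingOperator hq hs v] at hsmall
  have hfid := le_fidelity_spectralMoment (hammingOperator_characterBasis hq s)
    (norm_vertexVector v).le hε (D := hammingGap q s / n) (by positivity) (fun a ha => by
      rw [principalEigenvalue_hammingOperator hq hs] at ha ⊢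
      rw [hammingEigenvalue_zero_sub hq]
      have ha' : (1 : ℝ) ≤ hammingNorm a := by
        exact_mod_cast hammingNorm_pos_iff.mpr
          (fun h => ha ((hammingEigenvalue_eq_iff hq hs a).mpr h))
      gcongr
      exact le_mul_of_one_le_right hκ.le ha') hS0
  set S := spectralMoment (hammingOperator q s n) 1 (vertexVector v)
  set r := √(spectralMoment (hammingOperator q s n) 2 (vertexVector v))
  set ε := shadow (hammingOperator q s n) (vertexVector v)
  set κ := hammingGap q s
  have hrS : r ≤ 10 * S := by
    calc r ≤ 5 / κ := hr
      _ = 10 * (2 * κ)⁻¹ := by field_simp; norm_num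
      _ ≤ 10 * S := by gcongr
  have hratio : 1 / 10 ≤ S / r := by
    rw [le_div_iff₀ hr0]
    linarith
  have hDr : 1 / (2 * n) ≤ κ / n * r := by
    calc 1 / (2 * (n : ℝ)) = κ / n * (2 * κ)⁻¹ := by field_simp
      _ ≤ κ / n * r := by gcongr; exact hS.trans hSr
  have herr : (1 + Real.pi / 2) * (ε / (κ / n * r)) ≤ 1 / 20 := by
    have h1 : ε / (κ / n * r) ≤ 1 / 60 := by
      calc ε / (κ / n * r) ≤ ε / (1 / (2 * n)) := by gcongr
        _ = 2 * (n * ε) := by field_simp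
        _ ≤ 1 / 60 := by linarith
    have h2 : 1 + Real.pi / 2 ≤ 3 := by linarith [Real.pi_le_four]
    calc _ ≤ 3 * (1 / 60 : ℝ) := by gcongr
      _ = 1 / 20 := by norm_num
  have hamp : 1 / 20 ≤ S / r - (1 + Real.pi / 2) * (ε / (κ / n * r)) := by linarith
  refine ⟨Real.pi * r / (2 * ε * S), by positivity, ?_, ?_⟩
  · rw [div_le_div_iff₀ (by positivity) hε0]
    have h3 : Real.pi * r ≤ 4 * (10 * S) := by gcongr; exact Real.pi_le_four
    nlinarith
  · exact (pow_le_pow_left₀ (by norm_num) hamp 2).trans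
      (hfid ((by norm_num : (0 : ℝ) ≤ 1 / 20).trans hamp))

theorem isGroverian_hammingOperator (hq : 2 ≤ q) {s : ℝ} (hs : s < 1) :
    IsGroverian (hammingOperator q s) (hammingTargets q) := by
  have hκ := hammingGap_pos hq hs
  obtain ⟨C, hC, c, hc, N, h⟩ := isGroverianWith_spectralMoment_hammingOperator hq hs
  -- For `n = 0` the moment is an empty sum, hence zero, and a positive scaling has to be supplied.
  refine ⟨fun n => if n = 0 then 1 else
    spectralMoment (hammingOperator q s n) 1 (vertexVector 0), fun n => ?_,
    C, hC, c, hc, max N 1, fun n hn w hw => ?_⟩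
  · dsimp only
    split_ifs with hn
    · exact one_pos
    · exact lt_of_lt_of_le (by positivity)
        (le_spectralMoment_one_hammingOperator hq hs (Nat.one_le_iff_ne_zero.mpr hn) 0)
  · have hn0 : n ≠ 0 := by omega
    obtain ⟨v, rfl⟩ := hw
    have := h n ((le_max_left _ _).trans hn) _ ⟨v, rfl⟩
    dsimp only at this
    -- The formula for `S₁` does not involve the vertex, so vertex `0` can serve for all.
    rw [spectralMoment_hammingOperator hq hs 1 v,
      ← spectralMoment_hammingOperator hq hs 1 (0 : Fin n → ZMod q)] at this
    simpa only [if_neg hn0] using this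

theorem isTheta_spectralGap_hammingOperator (hq : 2 ≤ q) {s : ℝ} (hs : s < 1) :
    (fun n : ℕ => spectralGap (hammingOperator q s n)) =Θ[atTop] (fun n : ℕ => 1 / (n : ℝ)) := by
  have hκ := hammingGap_pos hq hs
  have heq : (fun n : ℕ => spectralGap (hammingOperator q s n)) =ᶠ[atTop]
      fun n : ℕ => hammingGap q s * (1 / (n : ℝ)) := by
    filter_upwards [eventually_ge_atTop 1] with n hn
    rw [spectralGap_hammingOperator hq hs hn]
    ring
  exact heq.trans_isTheta ((isTheta_const_mul_left hκ.ne').mpr (isTheta_refl _ _))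

theorem isTheta_spectralMoment_one_hammingOperator (hq : 2 ≤ q) {s : ℝ} (hs : s < 1)
    (v : (n : ℕ) → Fin n → ZMod q) :
    (fun n : ℕ => spectralMoment (hammingOperator q s n) 1 (vertexVector (v n)))
      =Θ[atTop] (fun _ : ℕ => (1 : ℝ)) := by
  have hκ := hammingGap_pos hq hs
  have hpos : ∀ n : ℕ, 1 ≤ n →
      0 < spectralMoment (hammingOperator q s n) 1 (vertexVector (v n)) := fun n hn =>
    lt_of_lt_of_le (by positivity) (le_spectralMoment_one_hammingOperator hq hs hn (v n))
  constructor
  · refine IsBigO.of_bound (5 / hammingGap q s) ?_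
    filter_upwards [eventually_ge_atTop 1] with n hn
    rw [Real.norm_of_nonneg (hpos n hn).le, norm_one, mul_one]
    exact (spectralMoment_one_le_sqrt_two_hammingOperator hq s _).trans
      (sqrt_spectralMoment_two_hammingOperator_le hq hs _)
  · refine IsBigO.of_bound (2 * hammingGap q s) ?_
    filter_upwards [eventually_ge_atTop 1] with n hn
    rw [Real.norm_of_nonneg (hpos n hn).le, norm_one]
    have h := le_spectralMoment_one_hammingOperator hq hs hn (v n)
    rwa [inv_le_iff_one_le_mul₀' (by positivity)] at h

/-- The shadow decays exponentially, whereas the gap is of order `1 / n` and `√S₁` stays bounded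
below. -/
theorem shadow_isLittleO_hammingOperator (hq : 2 ≤ q) {s : ℝ} (hs : s < 1)
    (v : (n : ℕ) → Fin n → ZMod q) :
    (fun n : ℕ => shadow (hammingOperator q s n) (vertexVector (v n))) =o[atTop]
      (fun n : ℕ => Real.sqrt (spectralMoment (hammingOperator q s n) 1 (vertexVector (v n))) *
        spectralGap (hammingOperator q s n)) := by
  have hκ := hammingGap_pos hq hs
  have h1 : (fun n : ℕ => shadow (hammingOperator q s n) (vertexVector (v n))) =o[atTop]
      (fun n : ℕ => 1 / (n : ℝ)) := by
    simp only [shadow_hammingOperator hq hs]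
    refine (isLittleO_iff_tendsto' ?_).mpr ?_
    · filter_upwards [eventually_ge_atTop 1] with n hn h
      have hn' : (n : ℝ) ≠ 0 := by exact_mod_cast (by omega : n ≠ 0)
      exact absurd h (one_div_ne_zero hn')
    · simpa [mul_comm] using tendsto_mul_inv_sqrt_pow hq
  refine h1.trans_isBigO ?_
  have h2 : (fun _ : ℕ => (1 : ℝ)) =O[atTop] fun n : ℕ =>
      √(spectralMoment (hammingOperator q s n) 1 (vertexVector (v n))) := by
    refine IsBigO.of_bound (√((2 * hammingGap q s)⁻¹))⁻¹ ?_
    filter_upwards [eventually_ge_atTop 1] with n hn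
    have hpos : 0 < √((2 * hammingGap q s)⁻¹) := Real.sqrt_pos.mpr (by positivity)
    rw [norm_one, Real.norm_of_nonneg (Real.sqrt_nonneg _), ← div_eq_inv_mul, le_div_iff₀ hpos,
      one_mul]
    exact Real.sqrt_le_sqrt (le_spectralMoment_one_hammingOperator hq hs hn (v n))
  simpa using h2.mul (isTheta_spectralGap_hammingOperator hq hs).2

end HammingSearch

end QuantumSearch

end

theorem mainTheorem9 (q : ℕ) [NeZero q] (hq : 2 ≤ q) (s : ℝ) (hs₀ : 0 ≤ s) (hs₁ : s < 1) :
    QuantumSearch.IsGroverian (QuantumSearch.hammingOperator q s)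
      (QuantumSearch.hammingTargets q) ∧
    QuantumSearch.IsGroverianWith (QuantumSearch.hammingOperator q s)
      (QuantumSearch.hammingTargets q)
      (fun n w => QuantumSearch.spectralMoment (QuantumSearch.hammingOperator q s n) 1 w) ∧
    (∀ n : ℕ, 1 ≤ n →
      QuantumSearch.IsNormalized (2 * s - 1) (QuantumSearch.hammingOperator q s n)) ∧
    (fun n : ℕ => QuantumSearch.spectralGap (QuantumSearch.hammingOperator q s n))
      =Θ[atTop] (fun n : ℕ => 1 / (n : ℝ)) ∧
    ∀ v : (n : ℕ) → Fin n → ZMod q,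
      (∀ n : ℕ, QuantumSearch.shadow (QuantumSearch.hammingOperator q s n)
        (QuantumSearch.vertexVector (v n)) = (q : ℝ) ^ (-(n : ℝ) / 2)) ∧
      (fun n : ℕ => QuantumSearch.spectralMoment (QuantumSearch.hammingOperator q s n) 1
        (QuantumSearch.vertexVector (v n))) =Θ[atTop] (fun _ : ℕ => (1 : ℝ)) ∧
      (fun n : ℕ => QuantumSearch.shadow (QuantumSearch.hammingOperator q s n)
        (QuantumSearch.vertexVector (v n))) =o[atTop]
      (fun n : ℕ => Real.sqrt (QuantumSearch.spectralMoment (QuantumSearch.hammingOperator q s n) 1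
        (QuantumSearch.vertexVector (v n))) *
        QuantumSearch.spectralGap (QuantumSearch.hammingOperator q s n)) := by
  refine ⟨QuantumSearch.isGroverian_hammingOperator hq hs₁,
    QuantumSearch.isGroverianWith_spectralMoment_hammingOperator hq hs₁,
    fun n hn => QuantumSearch.isNormalized_hammingOperator hq hs₁ hn,
    QuantumSearch.isTheta_spectralGap_hammingOperator hq hs₁, fun v => ⟨fun n => ?_,
    QuantumSearch.isTheta_spectralMoment_one_hammingOperator hq hs₁ v,
    QuantumSearch.shadow_isLittleO_hammingOperator hq hs₁ v⟩⟩
  rw [QuantumSearch.shadow_hammingOperator hq hs₁, Real.sqrt_eq_rpow,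
    ← Real.rpow_neg (by positivity), ← Real.rpow_natCast, ← Real.rpow_mul (by positivity)]
  congr 1
  ring
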